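/- Let $\mathcal X$ be a finite non-empty set, $k:\mathcal X\times\mathcal X\to\mathbb R$ a positive semidefinite kernel with $k(x,x)\le 1$ for all $x$, $\sigma>0$ and $\delta\in(0,1)$. Let $f\sim\mathcal{GP}(0,k)$ on $\mathcal X$, let $(\epsilon_t)_{t\ge1}$ be i.i.d. $\mathcal N(0,\sigma^2)$, and let $(\zeta_t)_{t\ge1}$ be independent, where $\zeta_t$ has the shifted exponential density $\lambda e^{-\lambda(z-s_t)}\mathbf 1_{\{z\ge s_t\}}$ with $$\lambda=\tfrac12,\qquad s_t=2\log\frac{|\mathcal X|\,t^2\pi^2}{6\delta};$$ assume that $f$, $(\epsilon_t)_t$, $(\zeta_t)_t$, and any randomness used for breaking ties, are mutually independent. For data $(x_1,y_1),\dots,(x_{t-1},y_{t-1})$ let $K=(k(x_i,x_j))_{i,j<t}$, $k_{t-1}(x)=(k(x,x_i))_{i<t}$, $y=(y_i)_{i<t}$, and let $$\mu_{t-1}(x)=k_{t-1}(x)^\top(K+\sigma^2I)^{-1}y,\qquad \sigma_{t-1}^2(x)=k(x,x)-k_{t-1}(x)^\top(K+\sigma^2I)^{-1}k_{t-1}(x)$$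 be the posterior mean and variance. IRGP-UCB chooses in round $t=1,2,\dots$ $$x_t\in\operatorname*{arg\,max}_{x\in\mathcal X}\ \mu_{t-1}(x)+\zeta_t^{1/2}\sigma_{t-1}(x),$$ where ties are broken by any measurable rule that depends only on the past data, $\zeta_t$ and the tie-breaking randomness, and then observes $y_t=f(x_t)+\epsilon_t$. Let $R_T=\sum_{t=1}^T\bigl(\max_{x\in\mathcal X}f(x)-f(x_t)\bigr)$, let $C_1=2/\log(1+\sigma^{-2})$, and let $\gamma_T$ be the maximum information gain, i.e. the maximum over $a_1,\dots,a_T\in\mathcal X$ (repetitions allowed) of the Shannon mutual information $I(y_A;f_A)$, where $f_A=(f(a_i))_{i\le T}$ and $y_A=f_A+\epsilon_A$ with $\epsilon_A\sim\mathcal N(0,\sigma^2I_T)$ independent of $f_A$. Put $$B_T=2\sqrt{C_1\gamma_T\left(Ts_T+T+2\sqrt{T\log\frac{\pi^2T^2}{3\delta}}+2\log\frac{\pi^2T^2}{3\delta}\right)} .$$ Then $$\Pr\bigl(\forall\,T\ge1:\ R_T\le B_T\bigr)\ \ge\ 1-\delta .$$ Moreover, $B_T$ is of the same order as the GP-UCB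 bound $G_T=\sqrt{8\,T s_T\gamma_T/\log(1+\sigma^{-2})}$ (the high-probability regret bound for the deterministic confidence parameters $\beta_t=s_t$): $G_T\le B_T\le 3\,G_T$ for all $T\ge1$. -/

import Mathlib

open MeasureTheory ProbabilityTheory InformationTheory
open scoped ENNReal NNReal Matrix

noncomputable section

namespace IRGPUCB

/-! ### The Gaussian process posterior -/

section Posterior

variable {X : Type*}

/-- The kernel matrix `(k(xᵢ, xⱼ))ᵢⱼ` of the points `x₁, …, xₙ`. -/
def kernelMatrix (k : X → X → ℝ) {n : ℕ} (a : Fin n → X) : Matrix (Fin n) (Fin n) ℝ :=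
  Matrix.of fun i j => k (a i) (a j)

/-- The vector `(k(x, x₁), …, k(x, xₙ))`. -/
def kernelVector (k : X → X → ℝ) {n : ℕ} (a : Fin n → X) (x : X) : Fin n → ℝ :=
  fun i => k x (a i)

/-- The posterior mean `k(x)ᵀ (K + σ² I)⁻¹ y` at `x`, given the data `D = ((xᵢ, yᵢ))ᵢ`. -/
def postMean (k : X → X → ℝ) (σ : ℝ) {n : ℕ} (D : Fin n → X × ℝ) (x : X) : ℝ :=
  kernelVector k (fun i => (D i).1) x ⬝ᵥ
    ((kernelMatrix k (fun i => (D i).1) + σ ^ 2 • (1 : Matrix (Fin n) (Fin n) ℝ))⁻¹ *ᵥ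
      fun i => (D i).2)

/-- The posterior variance `k(x, x) - k(x)ᵀ (K + σ² I)⁻¹ k(x)` at `x`, given the data `D`. -/
def postVar (k : X → X → ℝ) (σ : ℝ) {n : ℕ} (D : Fin n → X × ℝ) (x : X) : ℝ :=
  k x x - kernelVector k (fun i => (D i).1) x ⬝ᵥ
    ((kernelMatrix k (fun i => (D i).1) + σ ^ 2 • (1 : Matrix (Fin n) (Fin n) ℝ))⁻¹ *ᵥ
      kernelVector k (fun i => (D i).1) x)

/-- The upper confidence bound with confidence parameter `z`: posterior mean plus `√z` times
posterior standard deviation. -/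
def ucb (k : X → X → ℝ) (σ : ℝ) {n : ℕ} (D : Fin n → X × ℝ) (z : ℝ) (x : X) : ℝ :=
  postMean k σ D x + √z * √(postVar k σ D x)

end Posterior

/-! ### The shifted exponential distribution -/

/-- The shifted exponential distribution with shift `s` and rate `lam`: its density is
`lam * exp (-lam (z - s))` for `z ≥ s`, and `0` otherwise. -/
def shiftedExp (s lam : ℝ) : Measure ℝ :=
  volume.withDensity fun z =>
    ENNReal.ofReal (if s ≤ z then lam * Real.exp (-lam * (z - s)) else 0)

/-- The shifted exponential distribution is the law of `s + Z` with `Z` exponential. -/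
theorem shiftedExp_eq_map (s lam : ℝ) :
    shiftedExp s lam = (expMeasure lam).map (fun z => s + z) := by
  have hexp : expMeasure lam = volume.withDensity (exponentialPDF lam) := rfl
  have hm : MeasurePreserving (MeasurableEquiv.addLeft s) (volume : Measure ℝ) volume :=
    measurePreserving_add_left volume s
  ext A hA
  have hmeas : Measurable (fun z : ℝ => s + z) := by fun_prop
  rw [Measure.map_apply hmeas hA, hexp, shiftedExp, withDensity_apply _ hA,
    withDensity_apply _ (hmeas hA), ← hm.setLIntegral_comp_preimage_emb
      (MeasurableEquiv.addLeft s).measurableEmbedding]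
  refine lintegral_congr fun z => ?_
  rw [exponentialPDF_eq]
  simp

/-! ### Maximum information gain -/

/-- The Shannon mutual information of two random variables: the Kullback-Leibler divergence of
their joint law from the product of their laws. -/
def mutualInfo {Ω α β : Type*} [MeasurableSpace Ω] [MeasurableSpace α] [MeasurableSpace β]
    (Y : Ω → α) (F : Ω → β) (P : Measure Ω) : ℝ≥0∞ :=
  klDiv (P.map fun ω => (Y ω, F ω)) ((P.map Y).prod (P.map F))

/-- The joint law of independent `f_A ∼ N(0, K_A)` and `ε_A ∼ N(0, σ² I)`, where `K_A` is the
kernel matrix of the points `a₁, …, a_T`. -/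
def infoMeasure {X : Type*} (k : X → X → ℝ) (σ : ℝ) {T : ℕ} (a : Fin T → X) :
    Measure (EuclideanSpace ℝ (Fin T) × (Fin T → ℝ)) :=
  (multivariateGaussian 0 (kernelMatrix k a)).prod
    (Measure.pi fun _ : Fin T => gaussianReal 0 (σ ^ 2).toNNReal)

/-- The information gain `I(y_A ; f_A)` with `y_A = f_A + ε_A`. -/
def infoGain {X : Type*} (k : X → X → ℝ) (σ : ℝ) {T : ℕ} (a : Fin T → X) : ℝ≥0∞ :=
  mutualInfo (fun (p : EuclideanSpace ℝ (Fin T) × (Fin T → ℝ)) (i : Fin T) => p.1 i + p.2 i)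
    (fun p (i : Fin T) => p.1 i) (infoMeasure k σ a)

/-- The maximum information gain `γ_T`: the maximum of `I(y_A ; f_A)` over all
`A = (a₁, …, a_T)` in `X`, where points may be repeated. -/
def mig {X : Type*} (k : X → X → ℝ) (σ : ℝ) (T : ℕ) : ℝ :=
  (⨆ a : Fin T → X, infoGain k σ a).toReal

/-! ### The probabilistic model and the algorithm

Rounds are numbered from `0` in the code: round `n` here is round `t = n + 1` of the algorithm. -/

/-- The random inputs of the algorithm under `P`: the objective `f` is a centered Gaussian process
with covariance `k`, the noise `ε` is i.i.d. `N(0, σ²)`, the confidence parameters are independent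
with `ζ_t` shifted exponential with parameters `s t` and `lam`, and `U` is a random element of an
arbitrary space (used only to break ties). These four objects are mutually independent. -/
structure Model {Ω X Ξ : Type*} [MeasurableSpace Ω] [MeasurableSpace Ξ] (P : Measure Ω)
    (k : X → X → ℝ) (σ : ℝ) (s : ℕ → ℝ) (lam : ℝ)
    (f : X → Ω → ℝ) (ε ζ : ℕ → Ω → ℝ) (U : Ω → Ξ) : Prop where
  gaussian : IsGaussianProcess f P
  mean_zero : ∀ x, ∫ ω, f x ω ∂P = 0
  cov_eq : ∀ x x', cov[f x, f x'; P] = k x x'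
  noise_law : ∀ n, HasLaw (ε n) (gaussianReal 0 (σ ^ 2).toNNReal) P
  noise_indep : iIndepFun ε P
  zeta_law : ∀ n, HasLaw (ζ n) (shiftedExp (s (n + 1)) lam) P
  zeta_indep : iIndepFun ζ P
  tie_aemeasurable : AEMeasurable U P
  indep_f : IndepFun (fun ω x => f x ω) (fun ω => ((fun n => ε n ω), (fun n => ζ n ω), U ω)) P
  indep_noise : IndepFun (fun ω n => ε n ω) (fun ω => ((fun n => ζ n ω), U ω)) P
  indep_zeta : IndepFun (fun ω n => ζ n ω) U P

/-- `sel` is a measurable rule that picks, from the past data `D`, the confidence parameter `z` and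
the tie-breaking randomness `u`, a maximizer of the upper confidence bound. -/
structure IsSelectionRule {X Ξ : Type*} [MeasurableSpace X] [MeasurableSpace Ξ]
    (k : X → X → ℝ) (σ : ℝ) (sel : ∀ n : ℕ, (Fin n → X × ℝ) → ℝ → Ξ → X) : Prop where
  measurable : ∀ n, Measurable fun p : (Fin n → X × ℝ) × ℝ × Ξ => sel n p.1 p.2.1 p.2.2
  argmax : ∀ n D z u x, ucb k σ D z x ≤ ucb k σ D z (sel n D z u)

/-- `x` and `y` are the queried points and the observations of the algorithm: in each round the
point is selected from the data of the previous rounds and a fresh confidence parameter, and then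
a noisy value of `f` at this point is observed. -/
structure IsRun {Ω X Ξ : Type*} (sel : ∀ n : ℕ, (Fin n → X × ℝ) → ℝ → Ξ → X)
    (f : X → Ω → ℝ) (ε ζ : ℕ → Ω → ℝ) (U : Ω → Ξ)
    (x : ℕ → Ω → X) (y : ℕ → Ω → ℝ) : Prop where
  query : ∀ n ω, x n ω = sel n (fun i : Fin n => (x i ω, y i ω)) (ζ n ω) (U ω)
  observe : ∀ n ω, y n ω = f (x n ω) ω + ε n ω

/-- The cumulative regret `R_T`, the sum of `max f - f(x_t)` over the first `T` rounds. -/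
def cumRegret {Ω X : Type*} (f : X → Ω → ℝ) (x : ℕ → Ω → X) (T : ℕ) (ω : Ω) : ℝ :=
  ∑ n ∈ Finset.range T, ((⨆ x', f x' ω) - f (x n ω) ω)

/-! ### Constants and bounds -/

/-- The shift `s_t = 2 log (N t² π² / (6 δ))` for a domain with `N` points. -/
def shift (N : ℕ) (δ : ℝ) (t : ℕ) : ℝ :=
  2 * Real.log (N * (t : ℝ) ^ 2 * Real.pi ^ 2 / (6 * δ))

/-- `C₁ = 2 / log (1 + σ⁻²)`. -/
def C₁ (σ : ℝ) : ℝ := 2 / Real.log (1 + (σ ^ 2)⁻¹)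

/-- The bound
`2 √(C₁ γ_T (T s_T + T + 2 √(T log (π² T² / (3 δ))) + 2 log (π² T² / (3 δ))))`. -/
def regretBound {X : Type*} [Fintype X] (k : X → X → ℝ) (σ δ : ℝ) (T : ℕ) : ℝ :=
  2 * √(C₁ σ * mig k σ T *
    (T * shift (Fintype.card X) δ T + T
      + 2 * √(T * Real.log (Real.pi ^ 2 * (T : ℝ) ^ 2 / (3 * δ)))
      + 2 * Real.log (Real.pi ^ 2 * (T : ℝ) ^ 2 / (3 * δ))))

/-- The high-probability regret bound `√(8 T β_T γ_T / log (1 + σ⁻²))` of GP-UCB with the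
deterministic confidence parameters `β_t = 2 log (|X| t² π² / (6 δ))`. -/
def gpucbBound {X : Type*} [Fintype X] (k : X → X → ℝ) (σ δ : ℝ) (T : ℕ) : ℝ :=
  √(8 / Real.log (1 + (σ ^ 2)⁻¹) * T * shift (Fintype.card X) δ T * mig k σ T)

end IRGPUCB

end

/-! For a fixed design, the error of the posterior mean is a centred Gaussian variable with variance
the posterior variance. It is uncorrelated with the observations, hence independent of them, and
also of all confidence parameters and of the tie-breaking randomness. Given these, the interval of
half-width `√ζ * √postVar` fails with probability at most `exp (-ζ / 2)`. The design is adaptive,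
but it takes finitely many values in each round, and the event that it equals `a` is determined by
the observations at `a`, the confidence parameters and the tie-breaker. Summing over `a` gives
failure probability at most `E exp (-ζ / 2) = exp (-s_t / 2) / 2` at each point
(`Model.measure_confidence_fail_le`). A union over points and rounds costs `δ / 2`, by `∑ 1 / t² =
π² / 6`.

On the event that all intervals hold, the regret of a round is at most `2 √ζ σ(x)`, and
Cauchy-Schwarz separates `∑ ζ` from the sum of posterior variances. The latter is at most `C₁ γ_T`
(`sum_postVar_le`): the determinant of `K + σ² I` is the product of the predictive variances, and
`infoGain_eq` expresses the information gain through this determinant.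

The sum of the `ζ` is controlled by Chernoff's bound, at the cost of another `δ / 2`
(`measure_sum_zeta_gt_le`). The mean excess over the shifts is `2 T`, while the stated threshold
allows only `T s_T + T + 2 √(T L) + 2 L`; what is missing is supplied by the growth of the shifts,
since `∑ s_t` falls short of `T s_T` by `4 (T log T - log T!)`.

The comparison with GP-UCB is elementary, since `s_T ≥ 0.75` and `L ≤ log 2 + s_T / 2`. -/

namespace IRGPUCB

/-! ### Algebra of the Gaussian process posterior -/

section PosteriorAlgebra

variable {X : Type*} {k : X → X → ℝ} {σ : ℝ}

/-- The covariance matrix `K + σ² I` of noisy observations at the points `a`. -/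
noncomputable def obsMatrix (k : X → X → ℝ) (σ : ℝ) {n : ℕ} (a : Fin n → X) :
    Matrix (Fin n) (Fin n) ℝ :=
  kernelMatrix k a + σ ^ 2 • (1 : Matrix (Fin n) (Fin n) ℝ)

theorem kernelMatrix_posSemidef [Fintype X] (hk : (Matrix.of k).PosSemidef) {n : ℕ}
    (a : Fin n → X) : (kernelMatrix k a).PosSemidef :=
  hk.submatrix a

theorem obsMatrix_posDef [Fintype X] (hk : (Matrix.of k).PosSemidef) (hσ : 0 < σ) {n : ℕ}
    (a : Fin n → X) : (obsMatrix k σ a).PosDef :=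
  Matrix.PosDef.posSemidef_add (kernelMatrix_posSemidef hk a)
    (Matrix.PosDef.one.smul (by positivity))

theorem kernel_symm [Fintype X] (hk : (Matrix.of k).PosSemidef) (x y : X) : k x y = k y x := by
  have := congrFun (congrFun hk.isHermitian x) y
  simpa using this.symm

/-- The weights of the observations in the posterior mean at `x`. -/
noncomputable def postWeight (k : X → X → ℝ) (σ : ℝ) {n : ℕ} (a : Fin n → X) (x : X) : Fin n → ℝ :=
  (obsMatrix k σ a)⁻¹ *ᵥ kernelVector k a x

theorem obsMatrix_mulVec_postWeight [Fintype X] (hk : (Matrix.of k).PosSemidef) (hσ : 0 < σ)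
    {n : ℕ} (a : Fin n → X) (x : X) :
    obsMatrix k σ a *ᵥ postWeight k σ a x = kernelVector k a x := by
  rw [postWeight, Matrix.mulVec_mulVec, Matrix.mul_nonsing_inv, Matrix.one_mulVec]
  exact (obsMatrix_posDef hk hσ a).det_pos.ne'.isUnit

theorem obsMatrix_inv_transpose [Fintype X] (hk : (Matrix.of k).PosSemidef) (hσ : 0 < σ) {n : ℕ}
    (a : Fin n → X) : ((obsMatrix k σ a)⁻¹)ᵀ = (obsMatrix k σ a)⁻¹ := by
  simpa [Matrix.conjTranspose_eq_transpose_of_trivial] using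
    (obsMatrix_posDef hk hσ a).inv.isHermitian.eq

theorem postMean_eq [Fintype X] (hk : (Matrix.of k).PosSemidef) (hσ : 0 < σ) {n : ℕ}
    (D : Fin n → X × ℝ) (x : X) :
    postMean k σ D x = postWeight k σ (fun i => (D i).1) x ⬝ᵥ fun i => (D i).2 := by
  have h : postMean k σ D x = kernelVector k (fun i => (D i).1) x ⬝ᵥ
    ((obsMatrix k σ fun i => (D i).1)⁻¹ *ᵥ fun i => (D i).2) := rfl
  rw [h, postWeight, Matrix.dotProduct_mulVec, ← Matrix.mulVec_transpose,
    obsMatrix_inv_transpose hk hσ]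

theorem postVar_eq {n : ℕ} (D : Fin n → X × ℝ) (x : X) :
    postVar k σ D x = k x x - kernelVector k (fun i => (D i).1) x ⬝ᵥ
      postWeight k σ (fun i => (D i).1) x := rfl

theorem postVar_le [Fintype X] (hk : (Matrix.of k).PosSemidef) (hσ : 0 < σ) {n : ℕ}
    (D : Fin n → X × ℝ) (x : X) : postVar k σ D x ≤ k x x := by
  have := (obsMatrix_posDef hk hσ fun i => (D i).1).inv.posSemidef.dotProduct_mulVec_nonneg
    (kernelVector k (fun i => (D i).1) x)
  rw [postVar_eq, postWeight]
  simp only [star_trivial] at this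
  linarith

/-- The last factor is the Schur complement of the old observation matrix in the new one. The values
`b` are arbitrary because the posterior variance depends only on the query points. -/
theorem det_obsMatrix_succ [Fintype X] (hk : (Matrix.of k).PosSemidef) (hσ : 0 < σ) {n : ℕ}
    (a : ℕ → X) (b : ℕ → ℝ) :
    (obsMatrix k σ fun i : Fin (n + 1) => a i).det =
      (obsMatrix k σ fun i : Fin n => a i).det *
        (σ ^ 2 + postVar k σ (fun i : Fin n => (a i, b i)) (a n)) := by
  set A := obsMatrix k σ fun i : Fin n => a i with hA
  have hu : IsUnit A.det := (obsMatrix_posDef hk hσ _).det_pos.ne'.isUnit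
  let := A.invertibleOfIsUnitDet hu
  let v := kernelVector k (fun i : Fin n => a i) (a n)
  have hblock : (obsMatrix k σ fun i : Fin (n + 1) => a i).submatrix finSumFinEquiv
      finSumFinEquiv = Matrix.fromBlocks A (Matrix.of fun i (_ : Fin 1) => v i)
        (Matrix.of fun (_ : Fin 1) i => v i) (Matrix.of fun _ _ => σ ^ 2 + k (a n) (a n)) := by
    ext i j
    rcases i with i | i <;> rcases j with j | j
    · simp [hA, obsMatrix, kernelMatrix, Matrix.one_apply, Fin.ext_iff]
    · have : (i : ℕ) ≠ n := i.2.ne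
      simp [v, obsMatrix, kernelMatrix, kernelVector, Fin.ext_iff,
        this, kernel_symm hk (a i) (a n)]
    · have : n ≠ (j : ℕ) := j.2.ne'
      simp [v, obsMatrix, kernelMatrix, kernelVector, Fin.ext_iff, this]
    · obtain rfl := Subsingleton.elim i j
      simp [obsMatrix, kernelMatrix, add_comm]
  rw [← Matrix.det_submatrix_equiv_self finSumFinEquiv, hblock, Matrix.det_fromBlocks₁₁]
  congr 1
  rw [Matrix.det_unique, postVar_eq, postWeight, Matrix.invOf_eq_nonsing_inv, Matrix.sub_apply,
    Matrix.mul_assoc]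
  change _ - v ⬝ᵥ (A⁻¹ *ᵥ v) = _
  simp only [Matrix.of_apply]
  change _ = σ ^ 2 + (k (a n) (a n) - v ⬝ᵥ (A⁻¹ *ᵥ v))
  ring

theorem det_obsMatrix_eq_prod [Fintype X] (hk : (Matrix.of k).PosSemidef) (hσ : 0 < σ)
    (a : ℕ → X) (b : ℕ → ℝ) (T : ℕ) :
    (obsMatrix k σ fun i : Fin T => a i).det =
      ∏ n ∈ Finset.range T, (σ ^ 2 + postVar k σ (fun i : Fin n => (a i, b i)) (a n)) := by
  induction T with
  | zero => simp
  | succ n ih => rw [det_obsMatrix_succ hk hσ a b, ih, Finset.prod_range_succ]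

end PosteriorAlgebra

/-! ### Densities of Gaussian vectors -/

section Densities

open scoped MatrixOrder

theorem _root_.MeasureTheory.MeasurePreserving.map_withDensity_comp {α β : Type*}
    [MeasurableSpace α] [MeasurableSpace β] {μ : Measure α} {ν : Measure β} {g : α → β}
    (hg : MeasurePreserving g μ ν) {h : β → ℝ≥0∞} (hh : Measurable h) :
    (μ.withDensity (h ∘ g)).map g = ν.withDensity h := by
  ext s hs
  rw [Measure.map_apply hg.measurable hs, withDensity_apply _ (hg.measurable hs),
    withDensity_apply _ hs, ← hg.setLIntegral_comp_preimage hs hh]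
  rfl

theorem lintegral_fin_prod_volume {n : ℕ} (f : Fin n → ℝ → ℝ≥0∞) (hf : ∀ i, Measurable (f i)) :
    ∫⁻ x : Fin n → ℝ, ∏ i, f i (x i) = ∏ i, ∫⁻ x, f i x := by
  induction n with
  | zero => simp [volume_pi]
  | succ n ih =>
    have hmeas : Measurable fun x : Fin n → ℝ => ∏ i, f i.succ (x i) := by fun_prop
    rw [← (volume_preserving_piFinSuccAbove (fun _ : Fin (n + 1) => ℝ) 0).symm.lintegral_comp
      (by fun_prop)]
    simp_rw [MeasurableEquiv.piFinSuccAbove_symm_apply, Fin.insertNthEquiv,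
      Fin.prod_univ_succ, Fin.insertNth_zero, Equiv.coe_fn_mk, Fin.cons_succ, Fin.cons_zero]
    rw [← ih _ fun i => hf i.succ]
    exact lintegral_prod_mul (hf 0).aemeasurable hmeas.aemeasurable

theorem pi_withDensity_volume {n : ℕ} (φ : ℝ → ℝ≥0∞) (hφ : Measurable φ)
    [SigmaFinite ((volume : Measure ℝ).withDensity φ)] :
    Measure.pi (fun _ : Fin n => (volume : Measure ℝ).withDensity φ) =
      (volume : Measure (Fin n → ℝ)).withDensity fun x => ∏ i, φ (x i) := by
  refine Measure.pi_eq fun s hs => ?_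
  rw [withDensity_apply _ (MeasurableSet.univ_pi hs),
    ← lintegral_indicator (MeasurableSet.univ_pi hs)]
  have h1 : (Set.univ.pi s).indicator (fun x : Fin n → ℝ => ∏ i, φ (x i)) =
      fun x => ∏ i, (s i).indicator φ (x i) := by
    funext x
    by_cases hx : x ∈ Set.univ.pi s
    · rw [Set.indicator_of_mem hx]
      exact Finset.prod_congr rfl fun i _ => (Set.indicator_of_mem (hx i trivial) _).symm
    · rw [Set.indicator_of_notMem hx]
      simp only [Set.mem_pi, Set.mem_univ, true_imp_iff, not_forall] at hx
      obtain ⟨i, hi⟩ := hx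
      exact (Finset.prod_eq_zero (Finset.mem_univ i) (Set.indicator_of_notMem hi _)).symm
  rw [h1, lintegral_fin_prod_volume _ fun i => hφ.indicator (hs i)]
  refine Finset.prod_congr rfl fun i _ => ?_
  rw [lintegral_indicator (hs i), withDensity_apply _ (hs i)]

/-- The density of `n` independent centered Gaussian variables of variance `v`. -/
theorem pi_gaussianReal_eq_withDensity {n : ℕ} {v : ℝ≥0} (hv : v ≠ 0) :
    Measure.pi (fun _ : Fin n => gaussianReal 0 v) =
      (volume : Measure (Fin n → ℝ)).withDensity fun x =>
        ENNReal.ofReal ((√(2 * Real.pi * v))⁻¹ ^ n * Real.exp (-(x ⬝ᵥ x) / (2 * v))) := by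
  have : IsProbabilityMeasure ((volume : Measure ℝ).withDensity (gaussianPDF 0 v)) := by
    rw [← gaussianReal_of_var_ne_zero 0 hv]; infer_instance
  rw [gaussianReal_of_var_ne_zero 0 hv, pi_withDensity_volume _ (measurable_gaussianPDF 0 v)]
  congr 1
  funext x
  simp only [gaussianPDF]
  rw [← ENNReal.ofReal_prod_of_nonneg fun i _ => gaussianPDFReal_nonneg _ _ _]
  congr 1
  simp only [gaussianPDFReal, Finset.prod_mul_distrib, Finset.prod_const, Finset.card_univ,
    Fintype.card_fin, sub_zero, ← Real.exp_sum, dotProduct, ← Finset.sum_div,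
    Finset.sum_neg_distrib, pow_two]

/-- The density of a nondegenerate centered Gaussian vector. -/
theorem map_sqrt_pi_gaussianReal {n : ℕ} {M : Matrix (Fin n) (Fin n) ℝ} (hM : M.PosDef) :
    (Measure.pi fun _ : Fin n => gaussianReal 0 1).map (fun x => CFC.sqrt M *ᵥ x) =
      (volume : Measure (Fin n → ℝ)).withDensity fun y =>
        ENNReal.ofReal ((√M.det)⁻¹ * (√(2 * Real.pi))⁻¹ ^ n *
          Real.exp (-(y ⬝ᵥ (M⁻¹ *ᵥ y)) / 2)) := by
  set S := CFC.sqrt M with hS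
  have hSS : S * S = M := CFC.sqrt_mul_sqrt_self M hM.posSemidef.nonneg
  have hSpos : S.PosSemidef := Matrix.nonneg_iff_posSemidef.1 (CFC.sqrt_nonneg M)
  have hdet : S.det * S.det = M.det := by rw [← Matrix.det_mul, hSS]
  have hdet0 : S.det ≠ 0 := fun h => hM.det_pos.ne' (by rw [← hdet, h, zero_mul])
  have hdetS : S.det = √M.det := by
    rw [← hdet, Real.sqrt_mul_self hSpos.det_nonneg]
  have hST : Sᵀ = S := by simpa [Matrix.conjTranspose_eq_transpose_of_trivial] using
    hSpos.isHermitian.eq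
  have hinv : M⁻¹ = S⁻¹ * S⁻¹ := by rw [← hSS, Matrix.mul_inv_rev]
  have hquad : ∀ x, (S *ᵥ x) ⬝ᵥ (M⁻¹ *ᵥ (S *ᵥ x)) = x ⬝ᵥ x := by
    intro x
    rw [hinv, Matrix.mulVec_mulVec, Matrix.mul_assoc, Matrix.nonsing_inv_mul _ hdet0.isUnit,
      Matrix.mul_one, Matrix.dotProduct_mulVec, ← Matrix.mulVec_transpose,
      Matrix.transpose_nonsing_inv, hST, Matrix.mulVec_mulVec,
      Matrix.nonsing_inv_mul _ hdet0.isUnit, Matrix.one_mulVec]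
  -- The map `S` scales volume by `|det S|⁻¹ = (√det M)⁻¹`, which gives the normalising factor,
  -- while `hquad` rewrites the standard exponent.
  have hmap := Real.map_matrix_volume_pi_eq_smul_volume_pi hdet0
  have hmeas : Measurable (Matrix.toLin' S) :=
    (LinearMap.continuous_of_finiteDimensional _).measurable
  have hdens : Measurable fun y : Fin n → ℝ =>
      ENNReal.ofReal ((√(2 * Real.pi))⁻¹ ^ n * Real.exp (-(y ⬝ᵥ (M⁻¹ *ᵥ y)) / 2)) := by
    have : Continuous fun y : Fin n → ℝ => y ⬝ᵥ (M⁻¹ *ᵥ y) := by fun_prop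
    fun_prop
  have key := MeasurePreserving.map_withDensity_comp ⟨hmeas, hmap⟩ hdens
  rw [pi_gaussianReal_eq_withDensity one_ne_zero]
  convert! key using 1
  · congr 2
    funext x
    simp only [Function.comp, Matrix.toLin'_apply, hquad]
    simp
  · rw [withDensity_smul_measure, ← withDensity_smul _ hdens]
    congr 1
    funext y
    rw [Pi.smul_apply, smul_eq_mul, ← ENNReal.ofReal_mul (abs_nonneg _), hdetS,
      abs_of_nonneg (by positivity), mul_assoc]

/-- The law of `(F + ε, F)` has the expected density with respect to the product of its
marginals when `F` and `ε` are independent and `ε` and `F + ε` have densities. -/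
theorem map_add_fst_prod_eq_withDensity {n : ℕ} {μ : Measure (Fin n → ℝ)} [SFinite μ]
    {ψ p : (Fin n → ℝ) → ℝ≥0∞} (hψ : Measurable ψ) (hp : Measurable p)
    (hp0 : ∀ y, p y ≠ 0) (hpt : ∀ y, p y ≠ ∞)
    [SFinite ((volume : Measure (Fin n → ℝ)).withDensity p)]
    [SFinite ((volume : Measure (Fin n → ℝ)).withDensity ψ)] :
    (μ.prod (volume.withDensity ψ)).map (fun q => (q.1 + q.2, q.1)) =
      ((volume.withDensity p).prod μ).withDensity fun q => ψ (q.1 - q.2) / p q.1 := by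
  -- A shear followed by a swap: in each fibre it is a translation of Lebesgue measure. No density
  -- of `μ` is needed, so the kernel matrix may be singular.
  have hpres : MeasurePreserving (fun q : (Fin n → ℝ) × (Fin n → ℝ) => (q.1 + q.2, q.1))
      (μ.prod volume) (volume.prod μ) :=
    Measure.measurePreserving_swap.comp (MeasurePreserving.skew_product
      (g := fun a c => a + c) (MeasurePreserving.id μ) measurable_add
      (Filter.Eventually.of_forall fun a => map_add_left_eq_self volume a))
  have hψ' : Measurable fun q : (Fin n → ℝ) × (Fin n → ℝ) => ψ (q.1 - q.2) :=
    hψ.comp (measurable_fst.sub measurable_snd)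
  have hp' : Measurable fun q : (Fin n → ℝ) × (Fin n → ℝ) => p q.1 := hp.comp measurable_fst
  have hmul : (fun q : (Fin n → ℝ) × (Fin n → ℝ) => ψ (q.1 - q.2)) =
      (fun q => p q.1) * fun q => ψ (q.1 - q.2) / p q.1 := by
    funext q
    exact (ENNReal.mul_div_cancel (hp0 _) (hpt _)).symm
  have key := hpres.map_withDensity_comp hψ'
  rw [prod_withDensity_left hp, prod_withDensity_right hψ]
  have h : (volume.prod μ).withDensity (fun q => ψ (q.1 - q.2)) =
      ((volume.prod μ).withDensity fun q => p q.1).withDensity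
        fun q => ψ (q.1 - q.2) / p q.1 := by
    rw [hmul]
    exact withDensity_mul _ hp' (hψ'.div hp')
  rw [← h, ← key]
  congr 2
  funext q
  simp

end Densities

/-! ### The information gain -/

section InfoGain

open scoped MatrixOrder

theorem map_toLp_pi_gaussianReal {n : ℕ} (v : ℝ≥0) :
    (Measure.pi fun _ : Fin n => gaussianReal 0 v).map (WithLp.toLp 2) =
      multivariateGaussian 0 ((v : ℝ) • (1 : Matrix (Fin n) (Fin n) ℝ)) := by
  refine Measure.ext_of_charFun (E := EuclideanSpace ℝ (Fin n)) ?_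
  ext t
  have h1 : ((v : ℝ) • (1 : Matrix (Fin n) (Fin n) ℝ)).PosSemidef :=
    Matrix.PosSemidef.one.smul v.2
  rw [charFun_pi, charFun_multivariateGaussian h1]
  simp only [charFun_gaussianReal, ← Complex.exp_sum, Matrix.smul_mulVec, Matrix.one_mulVec]
  congr 1
  simp [dotProduct, Finset.sum_div]
  refine Finset.sum_congr rfl fun i _ => by ring

theorem multivariateGaussian_conv {n : ℕ} {K L : Matrix (Fin n) (Fin n) ℝ} (hK : K.PosSemidef)
    (hL : L.PosSemidef) :
    multivariateGaussian 0 K ∗ multivariateGaussian 0 L = multivariateGaussian 0 (K + L) := by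
  refine Measure.ext_of_charFun ?_
  ext t
  rw [charFun_conv, charFun_multivariateGaussian hK, charFun_multivariateGaussian hL,
    charFun_multivariateGaussian (hK.add hL), ← Complex.exp_add, Matrix.add_mulVec,
    dotProduct_add]
  congr 1
  push_cast
  simp
  ring

theorem map_sqrt_pi_eq_multivariateGaussian {n : ℕ} (M : Matrix (Fin n) (Fin n) ℝ) :
    (Measure.pi fun _ : Fin n => gaussianReal 0 1).map (fun x => CFC.sqrt M *ᵥ x) =
      (multivariateGaussian 0 M).map (WithLp.ofLp) := by
  rw [multivariateGaussian, ← map_pi_eq_stdGaussian, Measure.map_map (by fun_prop) (by fun_prop),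
    Measure.map_map (by fun_prop) (by fun_prop)]
  congr 1
  funext x
  simp

variable {X : Type*} {k : X → X → ℝ} {σ : ℝ}

instance {n : ℕ} (a : Fin n → X) : IsProbabilityMeasure (infoMeasure k σ a) := by
  unfold infoMeasure; infer_instance

theorem integral_sq_noise {T : ℕ} (a : Fin T → X) :
    Integrable (fun p : EuclideanSpace ℝ (Fin T) × (Fin T → ℝ) => p.2 ⬝ᵥ p.2)
        (infoMeasure k σ a) ∧
      ∫ p, p.2 ⬝ᵥ p.2 ∂infoMeasure k σ a = T * σ ^ 2 := by
  have hLp : MemLp id 2 (gaussianReal 0 (σ ^ 2).toNNReal) := memLp_id_gaussianReal' 2 (by simp)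
  have hint1 : Integrable (fun x : ℝ => x * x) (gaussianReal 0 (σ ^ 2).toNNReal) :=
    hLp.integrable_mul hLp
  have hval : ∫ x, x * x ∂gaussianReal 0 (σ ^ 2).toNNReal = σ ^ 2 := by
    have h := covariance_eq_sub hLp hLp
    rw [covariance_self hLp.aemeasurable, variance_id_gaussianReal] at h
    simp only [id, integral_id_gaussianReal, mul_zero, sub_zero] at h
    rw [Real.coe_toNNReal _ (sq_nonneg σ)] at h
    exact h.symm
  have hpres : ∀ i : Fin T, MeasurePreserving
      (fun p : EuclideanSpace ℝ (Fin T) × (Fin T → ℝ) => p.2 i) (infoMeasure k σ a)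
      (gaussianReal 0 (σ ^ 2).toNNReal) := fun i =>
    (measurePreserving_eval (fun _ : Fin T => gaussianReal 0 (σ ^ 2).toNNReal) i).comp
      measurePreserving_snd
  have hint : ∀ i : Fin T, Integrable
      (fun p : EuclideanSpace ℝ (Fin T) × (Fin T → ℝ) => p.2 i * p.2 i) (infoMeasure k σ a) :=
    fun i => (hpres i).integrable_comp_of_integrable hint1
  simp only [dotProduct]
  refine ⟨integrable_finsetSum _ fun i _ => hint i, ?_⟩
  rw [integral_finsetSum _ fun i _ => hint i]
  have : ∀ i : Fin T, ∫ p, p.2 i * p.2 i ∂infoMeasure k σ a = σ ^ 2 := by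
    intro i
    rw [← hval, ← (hpres i).map_eq, integral_map (hpres i).measurable.aemeasurable (by fun_prop)]
  simp [this]

variable [Fintype X]

theorem map_obs_infoMeasure (hk : (Matrix.of k).PosSemidef) {T : ℕ} (a : Fin T → X) :
    (infoMeasure k σ a).map (fun p (i : Fin T) => p.1 i + p.2 i) =
      (multivariateGaussian 0 (obsMatrix k σ a)).map WithLp.ofLp := by
  have hv : (((σ ^ 2).toNNReal : ℝ≥0) : ℝ) = σ ^ 2 := Real.coe_toNNReal _ (sq_nonneg σ)
  have hL : (σ ^ 2 • (1 : Matrix (Fin T) (Fin T) ℝ)).PosSemidef :=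
    Matrix.PosSemidef.one.smul (sq_nonneg σ)
  rw [obsMatrix, ← multivariateGaussian_conv (kernelMatrix_posSemidef hk a) hL, ← hv,
    ← map_toLp_pi_gaussianReal, Measure.conv,
    Measure.map_map (by fun_prop) (by fun_prop)]
  have : (multivariateGaussian 0 (kernelMatrix k a)).prod
      ((Measure.pi fun _ : Fin T => gaussianReal 0 (σ ^ 2).toNNReal).map (WithLp.toLp 2)) =
      (infoMeasure k σ a).map (Prod.map id (WithLp.toLp 2)) := by
    rw [infoMeasure, ← Measure.map_prod_map _ _ measurable_id (by fun_prop), Measure.map_id]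
  rw [this, Measure.map_map (by fun_prop) (by fun_prop)]
  rfl

theorem covariance_obs_infoMeasure (hk : (Matrix.of k).PosSemidef) (hσ : 0 < σ) {T : ℕ}
    (a : Fin T → X) (i j : Fin T) :
    Integrable (fun p : EuclideanSpace ℝ (Fin T) × (Fin T → ℝ) =>
        (p.1 i + p.2 i) * (p.1 j + p.2 j)) (infoMeasure k σ a) ∧
      ∫ p, (p.1 i + p.2 i) * (p.1 j + p.2 j) ∂infoMeasure k σ a = obsMatrix k σ a i j := by
  have hM := (obsMatrix_posDef hk hσ a).posSemidef
  set ν := multivariateGaussian 0 (obsMatrix k σ a)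
  have hLp : ∀ i, MemLp (fun x : EuclideanSpace ℝ (Fin T) => x i) 2 ν := fun i =>
    (IsGaussian.hasGaussianLaw_id (μ := ν)).map_fun (EuclideanSpace.proj i) |>.memLp_two
  have hmean : ∀ i, ∫ x, x i ∂ν = 0 := by
    intro i
    have := (EuclideanSpace.proj (𝕜 := ℝ) i).integral_comp_id_comm
      (IsGaussian.integrable_id (μ := ν))
    simpa [ν] using this
  have hmap := map_obs_infoMeasure (σ := σ) hk a
  have hY : Measurable fun (p : EuclideanSpace ℝ (Fin T) × (Fin T → ℝ)) (i : Fin T) =>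
    p.1 i + p.2 i := by fun_prop
  have hint : Integrable (fun y : Fin T → ℝ => y i * y j) (ν.map WithLp.ofLp) := by
    rw [integrable_map_measure (by fun_prop) (by fun_prop)]
    exact (hLp i).integrable_mul (hLp j)
  refine ⟨?_, ?_⟩
  · rw [← hmap] at hint
    exact hint.comp_measurable hY
  · have h1 : ∫ p, (p.1 i + p.2 i) * (p.1 j + p.2 j) ∂infoMeasure k σ a =
        ∫ y : Fin T → ℝ, y i * y j ∂((infoMeasure k σ a).map fun p i => p.1 i + p.2 i) := by
      rw [integral_map hY.aemeasurable (by fun_prop)]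
    rw [h1, hmap, integral_map (by fun_prop) (by fun_prop),
      ← covariance_eval_multivariateGaussian (μ := 0) hM i j,
      covariance_eq_sub (hLp i) (hLp j), hmean, zero_mul, sub_zero]
    rfl

/-- The mean is the trace of `M⁻¹ M`, where `M` is the covariance matrix of the observations. -/
theorem integral_quadratic_obs (hk : (Matrix.of k).PosSemidef) (hσ : 0 < σ) {T : ℕ}
    (a : Fin T → X) :
    Integrable (fun p : EuclideanSpace ℝ (Fin T) × (Fin T → ℝ) =>
        (fun i => p.1 i + p.2 i) ⬝ᵥ ((obsMatrix k σ a)⁻¹ *ᵥ fun i => p.1 i + p.2 i))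
        (infoMeasure k σ a) ∧
      ∫ p, (fun i => p.1 i + p.2 i) ⬝ᵥ ((obsMatrix k σ a)⁻¹ *ᵥ fun i => p.1 i + p.2 i)
        ∂infoMeasure k σ a = T := by
  set M := obsMatrix k σ a with hM
  have hexp : (fun p : EuclideanSpace ℝ (Fin T) × (Fin T → ℝ) =>
      (fun i => p.1 i + p.2 i) ⬝ᵥ (M⁻¹ *ᵥ fun i => p.1 i + p.2 i)) =
      fun p => ∑ i, ∑ j, M⁻¹ i j * ((p.1 i + p.2 i) * (p.1 j + p.2 j)) := by
    funext p
    simp only [dotProduct, Matrix.mulVec, Finset.mul_sum]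
    exact Finset.sum_congr rfl fun i _ => Finset.sum_congr rfl fun j _ => by ring
  have hint : ∀ i j, Integrable (fun p : EuclideanSpace ℝ (Fin T) × (Fin T → ℝ) =>
      M⁻¹ i j * ((p.1 i + p.2 i) * (p.1 j + p.2 j))) (infoMeasure k σ a) := fun i j =>
    (covariance_obs_infoMeasure hk hσ a i j).1.const_mul _
  rw [hexp]
  refine ⟨integrable_finsetSum _ fun i _ => integrable_finsetSum _ fun j _ => hint i j, ?_⟩
  rw [integral_finsetSum _ fun i _ => integrable_finsetSum _ fun j _ => hint i j]
  have hsymm : ∀ i j, M i j = M j i := fun i j => by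
    simpa using (congrFun (congrFun (obsMatrix_posDef hk hσ a).isHermitian.eq i) j).symm
  have : ∀ i, ∫ p, ∑ j, M⁻¹ i j * ((p.1 i + p.2 i) * (p.1 j + p.2 j)) ∂infoMeasure k σ a = 1 := by
    intro i
    rw [integral_finsetSum _ fun j _ => hint i j]
    simp_rw [integral_const_mul, (covariance_obs_infoMeasure hk hσ a i _).2, ← hM, hsymm i]
    rw [← Matrix.mul_apply, Matrix.nonsing_inv_mul _ (obsMatrix_posDef hk hσ a).det_pos.ne'.isUnit,
      Matrix.one_apply_eq]
  simp [this]

end InfoGain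

/-! ### The information gain as a log-determinant. -/

section InfoGainFormula

open scoped MatrixOrder

variable {X : Type*} [Fintype X] {k : X → X → ℝ} {σ : ℝ}

/-- The two quadratic forms have means `T σ²` and `T`, so their contributions `-T / 2` and `T / 2`
cancel and only the normalising constant survives. -/
theorem integral_logDensity (hk : (Matrix.of k).PosSemidef) (hσ : 0 < σ) {T : ℕ} (a : Fin T → X)
    (c : ℝ) :
    Integrable (fun p : EuclideanSpace ℝ (Fin T) × (Fin T → ℝ) =>
        c - (p.2 ⬝ᵥ p.2) / (2 * σ ^ 2) + ((fun i => p.1 i + p.2 i) ⬝ᵥ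
          ((obsMatrix k σ a)⁻¹ *ᵥ fun i => p.1 i + p.2 i)) / 2) (infoMeasure k σ a) ∧
      ∫ p, (c - (p.2 ⬝ᵥ p.2) / (2 * σ ^ 2) + ((fun i => p.1 i + p.2 i) ⬝ᵥ
          ((obsMatrix k σ a)⁻¹ *ᵥ fun i => p.1 i + p.2 i)) / 2) ∂infoMeasure k σ a = c := by
  obtain ⟨hi1, he1⟩ := integral_quadratic_obs hk hσ a
  obtain ⟨hi2, he2⟩ := integral_sq_noise (k := k) (σ := σ) a
  have hc : Integrable (fun p : EuclideanSpace ℝ (Fin T) × (Fin T → ℝ) =>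
      c - (p.2 ⬝ᵥ p.2) / (2 * σ ^ 2)) (infoMeasure k σ a) :=
    (integrable_const _).sub (hi2.div_const _)
  refine ⟨hc.add (hi1.div_const _), ?_⟩
  rw [integral_add hc (hi1.div_const _),
    integral_sub (integrable_const _) (hi2.div_const _), integral_div, integral_div, he1, he2,
    integral_const, probReal_univ, one_smul]
  have : σ ≠ 0 := hσ.ne'
  field_simp
  ring

/-- The information gain of a design is `½ log det (I + σ⁻² K)`. -/
theorem infoGain_eq (hk : (Matrix.of k).PosSemidef) (hσ : 0 < σ) {T : ℕ} (a : Fin T → X) :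
    infoGain k σ a = ENNReal.ofReal (Real.log ((obsMatrix k σ a).det / (σ ^ 2) ^ T) / 2) := by
  set M := obsMatrix k σ a with hM
  have hMpos : M.PosDef := obsMatrix_posDef hk hσ a
  have hdet := hMpos.det_pos
  set v : ℝ≥0 := (σ ^ 2).toNNReal
  have hv : (v : ℝ) = σ ^ 2 := Real.coe_toNNReal _ (sq_nonneg σ)
  have hv0 : v ≠ 0 := by
    rw [← NNReal.coe_ne_zero, hv]; positivity
  set c₁ : ℝ := (√(2 * Real.pi * v))⁻¹ ^ T with hc₁
  set c₂ : ℝ := (√M.det)⁻¹ * (√(2 * Real.pi))⁻¹ ^ T with hc₂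
  have hc₁pos : 0 < c₁ := by rw [hc₁, hv]; positivity
  have hc₂pos : 0 < c₂ := by positivity
  let ψ : (Fin T → ℝ) → ℝ≥0∞ := fun x => ENNReal.ofReal (c₁ * Real.exp (-(x ⬝ᵥ x) / (2 * v)))
  let p : (Fin T → ℝ) → ℝ≥0∞ := fun y =>
    ENNReal.ofReal (c₂ * Real.exp (-(y ⬝ᵥ (M⁻¹ *ᵥ y)) / 2))
  have hψ : Measurable ψ := by
    have : Continuous fun y : Fin T → ℝ => y ⬝ᵥ y := by fun_prop
    fun_prop
  have hp : Measurable p := by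
    have : Continuous fun y : Fin T → ℝ => y ⬝ᵥ (M⁻¹ *ᵥ y) := by fun_prop
    fun_prop
  have hp0 : ∀ y, p y ≠ 0 := fun y => by
    simp only [p, ne_eq, ENNReal.ofReal_eq_zero, not_le]; positivity
  have hpt : ∀ y, p y ≠ ∞ := fun y => ENNReal.ofReal_ne_top
  set μF : Measure (Fin T → ℝ) := (multivariateGaussian 0 (kernelMatrix k a)).map WithLp.ofLp
    with hμF
  have hμFp : IsProbabilityMeasure μF := Measure.isProbabilityMeasure_map (by fun_prop)
  have hN : Measure.pi (fun _ : Fin T => gaussianReal 0 v) = volume.withDensity ψ :=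
    pi_gaussianReal_eq_withDensity hv0
  have hY : (infoMeasure k σ a).map (fun p (i : Fin T) => p.1 i + p.2 i) =
      volume.withDensity p := by
    rw [map_obs_infoMeasure hk a, ← map_sqrt_pi_eq_multivariateGaussian,
      map_sqrt_pi_gaussianReal hMpos]
  have hYm : Measurable fun (p : EuclideanSpace ℝ (Fin T) × (Fin T → ℝ)) (i : Fin T) =>
    p.1 i + p.2 i := by fun_prop
  have hFm : Measurable fun (p : EuclideanSpace ℝ (Fin T) × (Fin T → ℝ)) (i : Fin T) =>
    p.1 i := by fun_prop
  have : IsProbabilityMeasure (volume.withDensity p) := by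
    rw [← hY]; exact Measure.isProbabilityMeasure_map hYm.aemeasurable
  have : IsProbabilityMeasure (volume.withDensity ψ) := by
    rw [← hN]; infer_instance
  have hF : (infoMeasure k σ a).map (fun p (i : Fin T) => p.1 i) = μF := by
    rw [hμF, ← Measure.fst_prod (μ := multivariateGaussian 0 (kernelMatrix k a))
      (ν := Measure.pi fun _ : Fin T => gaussianReal 0 v), Measure.fst,
      Measure.map_map (by fun_prop) (by fun_prop)]
    rfl
  let g : (Fin T → ℝ) × (Fin T → ℝ) → ℝ≥0∞ := fun q => ψ (q.1 - q.2) / p q.1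
  have hg : Measurable g :=
    (hψ.comp (measurable_fst.sub measurable_snd)).div (hp.comp measurable_fst)
  have hjoint : (infoMeasure k σ a).map (fun p => ((fun i => p.1 i + p.2 i), fun i => p.1 i)) =
      ((volume.withDensity p).prod μF).withDensity g := by
    rw [← map_add_fst_prod_eq_withDensity hψ hp hp0 hpt, ← hN, hμF,
      ← Measure.map_id (μ := Measure.pi _), Measure.map_prod_map _ _ (by fun_prop) measurable_id, Measure.map_map (by fun_prop)
      (by fun_prop)]
    rfl
  rw [infoGain, mutualInfo, hY, hF, hjoint]
  set ν := (volume.withDensity p).prod μF with hν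
  set π := ν.withDensity g
  have hac : π ≪ ν := withDensity_absolutelyContinuous _ _
  have hπp : IsProbabilityMeasure π := by
    rw [← hjoint]; exact Measure.isProbabilityMeasure_map (hYm.prodMk hFm).aemeasurable
  have hlog : ∀ q, Real.log (g q).toReal = Real.log (c₁ / c₂) -
      ((q.1 - q.2) ⬝ᵥ (q.1 - q.2)) / (2 * v) + (q.1 ⬝ᵥ (M⁻¹ *ᵥ q.1)) / 2 := by
    intro q
    simp only [g, ψ, p]
    rw [ENNReal.toReal_div, ENNReal.toReal_ofReal (by positivity),
      ENNReal.toReal_ofReal (by positivity), mul_div_mul_comm, ← Real.exp_sub,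
      Real.log_mul (by positivity) (Real.exp_ne_zero _), Real.log_exp]
    ring
  have hllr : llr π ν =ᵐ[π] fun q => Real.log (c₁ / c₂) -
      ((q.1 - q.2) ⬝ᵥ (q.1 - q.2)) / (2 * v) + (q.1 ⬝ᵥ (M⁻¹ *ᵥ q.1)) / 2 := by
    filter_upwards [hac.ae_le (Measure.rnDeriv_withDensity ν hg)] with q hq
    rw [llr, hq, hlog]
  have hcont : Continuous fun q : (Fin T → ℝ) × (Fin T → ℝ) => Real.log (c₁ / c₂) -
      ((q.1 - q.2) ⬝ᵥ (q.1 - q.2)) / (2 * v) + (q.1 ⬝ᵥ (M⁻¹ *ᵥ q.1)) / 2 := by fun_prop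
  obtain ⟨hi, he⟩ := integral_logDensity hk hσ a (Real.log (c₁ / c₂))
  have hcomp : ∀ p : EuclideanSpace ℝ (Fin T) × (Fin T → ℝ), Real.log (c₁ / c₂) -
      (((fun i => p.1 i + p.2 i) - fun i => p.1 i) ⬝ᵥ
        ((fun i => p.1 i + p.2 i) - fun i => p.1 i)) / (2 * v) +
      ((fun i => p.1 i + p.2 i) ⬝ᵥ (M⁻¹ *ᵥ fun i => p.1 i + p.2 i)) / 2 =
      Real.log (c₁ / c₂) - (p.2 ⬝ᵥ p.2) / (2 * σ ^ 2) +
        ((fun i => p.1 i + p.2 i) ⬝ᵥ (M⁻¹ *ᵥ fun i => p.1 i + p.2 i)) / 2 := by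
    intro p
    have : ((fun i => p.1 i + p.2 i) - fun i => p.1 i) = p.2 := by
      funext i; simp
    rw [this, hv]
  have hint : Integrable (llr π ν) π := by
    rw [integrable_congr hllr, ← hjoint, integrable_map_measure
      hcont.aestronglyMeasurable (hYm.prodMk hFm).aemeasurable]
    exact hi.congr (Filter.Eventually.of_forall fun p => (hcomp p).symm)
  rw [klDiv_of_ac_of_integrable hac hint]
  congr 1
  rw [integral_congr_ae hllr]
  -- The divergence of finite measures carries a correction by their total masses, which vanishes
  -- for probability measures.
  simp only [measureReal_def, measure_univ, ENNReal.toReal_one, add_sub_cancel_right]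
  have hcalc : ∫ q, Real.log (c₁ / c₂) -
      ((q.1 - q.2) ⬝ᵥ (q.1 - q.2)) / (2 * v) + (q.1 ⬝ᵥ (M⁻¹ *ᵥ q.1)) / 2 ∂π =
      Real.log (c₁ / c₂) := by
    rw [← hjoint, integral_map (hYm.prodMk hFm).aemeasurable hcont.aestronglyMeasurable]
    exact (integral_congr_ae (Filter.Eventually.of_forall hcomp)).trans he
  rw [hcalc]
  have hratio : c₁ / c₂ = √(M.det / (σ ^ 2) ^ T) := by
    rw [hc₁, hc₂, hv, Real.sqrt_mul (by positivity), Real.sqrt_sq hσ.le, Real.sqrt_div hdet.le,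
      ← pow_mul, mul_comm 2 T, pow_mul, Real.sqrt_sq (by positivity)]
    have := Real.sqrt_pos.2 hdet
    have : 0 < √(2 * Real.pi) := by positivity
    simp only [inv_pow, mul_pow]
    field_simp
  rw [hratio, Real.log_sqrt (by positivity)]

end InfoGainFormula

/-! ### The maximum information gain -/

section Mig

variable {X : Type*} [Fintype X] {k : X → X → ℝ} {σ : ℝ}

theorem toReal_infoGain_le_mig [Nonempty X] (hk : (Matrix.of k).PosSemidef) (hσ : 0 < σ) {T : ℕ}
    (a : Fin T → X) : (infoGain k σ a).toReal ≤ mig k σ T := by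
  refine ENNReal.toReal_mono ?_ (le_iSup _ a)
  obtain ⟨b, hb⟩ := exists_eq_ciSup_of_finite (f := fun a : Fin T → X => infoGain k σ a)
  rw [← hb, infoGain_eq hk hσ]
  exact ENNReal.ofReal_ne_top

/-- For `0 ≤ w ≤ 1`, Bernoulli's inequality gives `w log (1 + σ⁻²) ≤ log (1 + w σ⁻²)`. The
right-hand sides add up to the normalised log-determinant, which is twice an information gain. This
is where `k x x ≤ 1` enters. -/
theorem sum_postVar_le [Nonempty X] (hk : (Matrix.of k).PosSemidef) (hk_le : ∀ x, k x x ≤ 1)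
    (hσ : 0 < σ) (a : ℕ → X) (b : ℕ → ℝ)
    (h0 : ∀ n, 0 ≤ postVar k σ (fun i : Fin n => (a i, b i)) (a n)) (T : ℕ) :
    ∑ n ∈ Finset.range T, postVar k σ (fun i : Fin n => (a i, b i)) (a n) ≤
      C₁ σ * mig k σ T := by
  set w : ℕ → ℝ := fun n => postVar k σ (fun i : Fin n => (a i, b i)) (a n) with hw
  have hs : 0 < (σ ^ 2)⁻¹ := by positivity
  have hlog : 0 < Real.log (1 + (σ ^ 2)⁻¹) := Real.log_pos (by linarith)
  have hw1 : ∀ n, w n ≤ 1 := fun n => (postVar_le hk hσ _ _).trans (hk_le _)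
  have hstep : ∀ n, w n * Real.log (1 + (σ ^ 2)⁻¹) ≤ Real.log (1 + w n * (σ ^ 2)⁻¹) := by
    intro n
    rw [← Real.log_rpow (by linarith)]
    exact Real.log_le_log (by positivity)
      (rpow_one_add_le_one_add_mul_self (by linarith) (h0 n) (hw1 n))
  have hgain : ∑ n ∈ Finset.range T, Real.log (1 + w n * (σ ^ 2)⁻¹) ≤ 2 * mig k σ T := by
    have h1 : ∑ n ∈ Finset.range T, Real.log (1 + w n * (σ ^ 2)⁻¹) =
        Real.log ((obsMatrix k σ fun i : Fin T => a i).det / (σ ^ 2) ^ T) := by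
      have hpow : (σ ^ 2) ^ T = ∏ _n ∈ Finset.range T, σ ^ 2 := by simp
      rw [det_obsMatrix_eq_prod hk hσ a b, hpow, ← Finset.prod_div_distrib, Real.log_prod]
      · refine Finset.sum_congr rfl fun n _ => ?_
        congr 1
        field_simp
        rfl
      · intro n _
        have := h0 n
        positivity
    have h2 := toReal_infoGain_le_mig hk hσ fun i : Fin T => a i
    rw [infoGain_eq hk hσ, ← h1, ENNReal.toReal_ofReal] at h2
    · linarith
    · refine div_nonneg (Finset.sum_nonneg fun n _ => Real.log_nonneg ?_) zero_le_two
      have := mul_nonneg (h0 n) hs.le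
      linarith
  rw [C₁, div_mul_eq_mul_div, le_div_iff₀ hlog, Finset.sum_mul]
  exact (Finset.sum_le_sum fun n _ => hstep n).trans hgain

end Mig

/-! ### Elementary estimates -/

section Estimates

theorem shift_lower_bound {N : ℕ} (hN : 1 ≤ N) {δ : ℝ} (hδ : δ ∈ Set.Ioo (0 : ℝ) 1) {t : ℕ}
    (ht : 1 ≤ t) : 0.75 ≤ shift N δ t := by
  have hN' : (1 : ℝ) ≤ N := by exact_mod_cast hN
  have ht' : (1 : ℝ) ≤ t := by exact_mod_cast ht
  have hπ := Real.pi_gt_d2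
  have h0 := hδ.1
  have h1 := hδ.2
  -- Here `π² / 6 > 1.6`, and `2 (1 - 1 / 1.6) = 0.75` by `log x ≥ 1 - 1 / x`.
  have harg : (1.6 : ℝ) ≤ N * (t : ℝ) ^ 2 * Real.pi ^ 2 / (6 * δ) := by
    rw [le_div_iff₀ (by positivity)]
    have h2 : (1 : ℝ) ≤ N * (t : ℝ) ^ 2 := one_le_mul_of_one_le_of_one_le hN' (one_le_pow₀ ht')
    have h3 : (9.6 : ℝ) ≤ Real.pi ^ 2 := by nlinarith
    nlinarith
  have hlog := Real.one_sub_inv_le_log_of_pos (show (0 : ℝ) < 1.6 by norm_num)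
  have := Real.log_le_log (by norm_num) harg
  rw [shift]
  norm_num at hlog ⊢
  linarith

theorem log_tail_nonneg {δ : ℝ} (hδ : δ ∈ Set.Ioo (0 : ℝ) 1) {T : ℕ} (hT : 1 ≤ T) :
    0 ≤ Real.log (Real.pi ^ 2 * (T : ℝ) ^ 2 / (3 * δ)) := by
  have hT' : (1 : ℝ) ≤ T := by exact_mod_cast hT
  have h0 := hδ.1
  have h1 := hδ.2
  refine Real.log_nonneg ?_
  rw [le_div_iff₀ (by positivity)]
  have hπ := Real.pi_gt_three
  have h3 : (9 : ℝ) ≤ Real.pi ^ 2 := by nlinarith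
  have h2 : (1 : ℝ) ≤ (T : ℝ) ^ 2 := one_le_pow₀ hT'
  nlinarith

theorem log_tail_le {N : ℕ} (hN : 1 ≤ N) {δ : ℝ} (hδ : δ ∈ Set.Ioo (0 : ℝ) 1) {T : ℕ}
    (hT : 1 ≤ T) :
    Real.log (Real.pi ^ 2 * (T : ℝ) ^ 2 / (3 * δ)) ≤ Real.log 2 + shift N δ T / 2 := by
  have hN' : (1 : ℝ) ≤ N := by exact_mod_cast hN
  have hT' : (1 : ℝ) ≤ T := by exact_mod_cast hT
  have h0 := hδ.1
  have hpos : 0 < N * (T : ℝ) ^ 2 * Real.pi ^ 2 / (6 * δ) := by positivity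
  rw [shift, mul_div_cancel_left₀ _ two_ne_zero, ← Real.log_mul two_ne_zero hpos.ne']
  refine Real.log_le_log (by positivity) ?_
  have : 2 * (N * (T : ℝ) ^ 2 * Real.pi ^ 2 / (6 * δ)) =
      N * (Real.pi ^ 2 * (T : ℝ) ^ 2 / (3 * δ)) := by field_simp; norm_num
  rw [this]
  exact le_mul_of_one_le_left (by positivity) hN'

theorem two_mul_sqrt_mul_le_add {a b : ℝ} (ha : 0 ≤ a) (hb : 0 ≤ b) : 2 * √(a * b) ≤ a + b := by
  have : √(a * b) ≤ (a + b) / 2 :=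
    Real.sqrt_le_iff.2 ⟨by positivity, by nlinarith [sq_nonneg (a - b)]⟩
  linarith

theorem gpucbBound_le_regretBound_le {X : Type*} [Fintype X] [Nonempty X] (k : X → X → ℝ) {σ : ℝ}
    (hσ : 0 < σ) {δ : ℝ} (hδ : δ ∈ Set.Ioo (0 : ℝ) 1) {T : ℕ} (hT : 1 ≤ T) :
    gpucbBound k σ δ T ≤ regretBound k σ δ T ∧
      regretBound k σ δ T ≤ 3 * gpucbBound k σ δ T := by
  have hN : 1 ≤ Fintype.card X := Fintype.card_pos
  have hT' : (1 : ℝ) ≤ T := by exact_mod_cast hT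
  have hs := shift_lower_bound hN hδ hT
  have hL0 := log_tail_nonneg hδ hT
  have hL := log_tail_le hN hδ hT
  set s := shift (Fintype.card X) δ T
  set L := Real.log (Real.pi ^ 2 * (T : ℝ) ^ 2 / (3 * δ))
  have hlog : 0 < Real.log (1 + (σ ^ 2)⁻¹) :=
    Real.log_pos (by have : 0 < (σ ^ 2)⁻¹ := by positivity
                     linarith)
  have hγ : 0 ≤ mig k σ T := ENNReal.toReal_nonneg
  have hC : 0 ≤ C₁ σ * mig k σ T := mul_nonneg (div_nonneg zero_le_two hlog.le) hγ
  have hsq := two_mul_sqrt_mul_le_add (zero_le_one.trans hT') hL0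
  have hB : regretBound k σ δ T =
      √(4 * (C₁ σ * mig k σ T * (T * s + T + 2 * √(T * L) + 2 * L))) := by
    rw [regretBound, Real.sqrt_mul (by norm_num : (0 : ℝ) ≤ 4)]
    congr 1
    rw [show (4 : ℝ) = 2 ^ 2 by norm_num, Real.sqrt_sq zero_le_two]
  have hG : gpucbBound k σ δ T = √(4 * (C₁ σ * mig k σ T * (T * s))) := by
    rw [gpucbBound, C₁]
    congr 1
    ring
  have hG3 : 3 * gpucbBound k σ δ T = √(9 * (4 * (C₁ σ * mig k σ T * (T * s)))) := by
    rw [hG, Real.sqrt_mul (by norm_num : (0 : ℝ) ≤ 9), show (9 : ℝ) = 3 ^ 2 by norm_num,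
      Real.sqrt_sq (by norm_num : (0 : ℝ) ≤ 3)]
  have hln2 := Real.log_two_lt_d9
  rw [hG3, hB, hG]
  refine ⟨Real.sqrt_le_sqrt ?_, Real.sqrt_le_sqrt ?_⟩
  · have : 0 ≤ √(T * L) := Real.sqrt_nonneg _
    gcongr 4 * (C₁ σ * mig k σ T * ?_)
    linarith
  -- By `2 √(T L) ≤ T + L`, the left side is at most `T s + 2 T + 3 L`, and `L ≤ log 2 + s / 2` with
  -- `s ≥ 0.75` leaves enough room even at `T = 1`.
  · have : (T : ℝ) * s + T + 2 * √(T * L) + 2 * L ≤ 9 * (T * s) := by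
      nlinarith [mul_nonneg (sub_nonneg.2 hT') (sub_nonneg.2 hs)]
    have := mul_le_mul_of_nonneg_left this hC
    linarith

theorem cubic_le_exp {r : ℝ} (hr : 0 ≤ r) : 1 + r + r ^ 2 / 2 + r ^ 3 / 6 ≤ Real.exp r := by
  have := Real.sum_le_exp_of_nonneg hr 4
  simp [Finset.sum_range_succ, Nat.factorial] at this
  linarith

/-- The exponent condition for Chernoff's bound when `T ≥ 3`. The exponential is split as `exp (a -
1)`, which is at least `a`, times `exp (1 / 2 + r)`, which is estimated by the cubic Taylor
polynomial. -/
theorem quadratic_le_exp_of_one_le {a r : ℝ} (ha : 1 ≤ a) (hr : 0 ≤ r) :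
    1 / 2 + a + r + r ^ 2 ≤ Real.exp (a - 1 / 2 + r) := by
  have h1 : (1.64 : ℝ) ≤ Real.exp (1 / 2) := by
    have := cubic_le_exp (show (0 : ℝ) ≤ 1 / 2 by norm_num)
    norm_num at this ⊢
    linarith
  have h2 := cubic_le_exp hr
  have h3 : 3 / 2 + r + r ^ 2 ≤ Real.exp (1 / 2) * Real.exp r := by
    have h4 : 1.64 * (1 + r + r ^ 2 / 2 + r ^ 3 / 6) ≤ Real.exp (1 / 2) * Real.exp r := by
      gcongr
    nlinarith [mul_nonneg hr (sq_nonneg (r - 1 / 3)), sq_nonneg r]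
  have h4 : a ≤ Real.exp (a - 1) := by linarith [Real.add_one_le_exp (a - 1)]
  have h5 : Real.exp (a - 1 / 2 + r) = Real.exp (a - 1) * (Real.exp (1 / 2) * Real.exp r) := by
    rw [← Real.exp_add, ← Real.exp_add]; congr 1; ring
  rw [h5]
  nlinarith [mul_le_mul h4 h3 (by positivity) (Real.exp_nonneg _),
    mul_nonneg (sub_nonneg.2 ha) (by positivity : (0 : ℝ) ≤ 1 / 2 + r + r ^ 2)]

/-- The same condition for `T = 2`, where `a = log 2 < 1`; now `exp (a - 1 / 2) = 2 / √e`. -/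
theorem quadratic_le_exp_log_two {r : ℝ} (hr : 0 ≤ r) :
    1 / 2 + Real.log 2 + r + r ^ 2 ≤ Real.exp (Real.log 2 - 1 / 2 + r) := by
  have h1 : (1.213 : ℝ) ≤ Real.exp (Real.log 2 - 1 / 2) := by
    rw [Real.exp_sub, Real.exp_log two_pos, le_div_iff₀ (Real.exp_pos _)]
    have h : Real.exp (1 / 2) ≤ 1.6488 := by
      have h2 : Real.exp (1 / 2) ^ 2 = Real.exp 1 := by
        rw [← Real.exp_nat_mul]; norm_num
      have := Real.exp_one_lt_d9
      refine le_of_sq_le_sq ?_ (by norm_num)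
      rw [h2]; norm_num at this ⊢; linarith
    linarith
  have h2 := cubic_le_exp hr
  have hln2 := Real.log_two_lt_d9
  rw [Real.exp_add]
  have h4 : 1.213 * (1 + r + r ^ 2 / 2 + r ^ 3 / 6) ≤
      Real.exp (Real.log 2 - 1 / 2) * Real.exp r := by gcongr
  -- Apart from a positive constant, the difference is `r` times a positive quadratic whose minimum
  -- lies near `0.97`.
  nlinarith [mul_nonneg hr (sq_nonneg (r - 0.97)), sq_nonneg r]

/-- The increment of the right side is `T log ((T + 1) / T) ≥ T / (T + 1) ≥ 1 / 2`. The base case is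
`exp (3 / 2) ≤ 4.5`; the inequality fails for `T = 2`. -/
theorem half_le_mul_log_sub_log_factorial {T : ℕ} (hT : 3 ≤ T) :
    (T : ℝ) / 2 ≤ T * Real.log T - Real.log T.factorial := by
  induction T, hT using Nat.le_induction with
  | base =>
    have h1 : Real.exp (3 / 2) ≤ 4.5 := by
      have h2 : Real.exp (3 / 2) ^ 2 = Real.exp 1 ^ 3 := by
        rw [← Real.exp_nat_mul, ← Real.exp_nat_mul]; norm_num
      have h3 : Real.exp 1 ^ 3 ≤ 2.7183 ^ 3 := by
        have := Real.exp_one_lt_d9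
        gcongr
        norm_num at this ⊢; linarith
      refine le_of_sq_le_sq ?_ (by norm_num)
      rw [h2]; norm_num at h3 ⊢; linarith
    have h2 : (3 / 2 : ℝ) ≤ Real.log 4.5 := (Real.le_log_iff_exp_le (by norm_num)).2 h1
    have h3 : Real.log 4.5 = 3 * Real.log 3 - Real.log 6 := by
      rw [show (3 : ℝ) * Real.log 3 = Real.log (3 ^ 3) by rw [Real.log_pow]; norm_num,
        ← Real.log_div (by norm_num) (by norm_num)]
      norm_num
    simp [Nat.factorial] at *
    linarith
  | succ T hT ih =>
    have hT0 : (3 : ℝ) ≤ T := by exact_mod_cast hT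
    rw [Nat.factorial_succ]
    push_cast
    rw [Real.log_mul (by positivity) (by positivity)]
    have h1 := Real.one_sub_inv_le_log_of_pos (show (0 : ℝ) < (T + 1) / T by positivity)
    rw [Real.log_div (by positivity) (by positivity), inv_div] at h1
    have h2 : (T : ℝ) * (1 - T / (T + 1)) = T / (T + 1) := by field_simp; ring
    have h3 : (1 / 2 : ℝ) ≤ T / (T + 1) := by
      rw [div_le_div_iff₀ (by norm_num) (by positivity)]; linarith
    have h4 := mul_le_mul_of_nonneg_left h1 (by positivity : (0 : ℝ) ≤ T)
    rw [h2] at h4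
    linarith

/-- The shift is a constant plus `4 log t`. The subtracted term is the slack that pays for the small
threshold in `measure_sum_zeta_gt_le`. -/
theorem sum_shift {N : ℕ} (hN : 1 ≤ N) {δ : ℝ} (hδ : 0 < δ) {T : ℕ} (hT : 1 ≤ T) :
    ∑ n ∈ Finset.range T, shift N δ (n + 1) =
      T * shift N δ T - 4 * (T * Real.log T - Real.log T.factorial) := by
  have hN' : (1 : ℝ) ≤ N := by exact_mod_cast hN
  have hsplit : ∀ t : ℕ, 1 ≤ t → shift N δ t =
      2 * Real.log (N * Real.pi ^ 2 / (6 * δ)) + 4 * Real.log t := by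
    intro t ht
    have ht' : (1 : ℝ) ≤ t := by exact_mod_cast ht
    rw [shift, show N * (t : ℝ) ^ 2 * Real.pi ^ 2 / (6 * δ) =
      N * Real.pi ^ 2 / (6 * δ) * t ^ 2 by ring,
      Real.log_mul (by positivity) (by positivity), Real.log_pow]
    push_cast
    ring
  have hfac : Real.log T.factorial = ∑ n ∈ Finset.range T, Real.log ((n + 1 : ℕ) : ℝ) := by
    rw [← Finset.prod_range_add_one_eq_factorial, Nat.cast_prod, Real.log_prod]
    intro n _
    positivity
  rw [Finset.sum_congr rfl fun n _ => hsplit (n + 1) (by omega), Finset.sum_add_distrib,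
    Finset.sum_const, ← Finset.mul_sum, ← hfac, hsplit T hT]
  simp
  ring

end Estimates

/-! ### Tail bounds -/

section Tails

/-- After translation by `c`, use `(x + c)² ≥ x² + c²` for `x > 0`. Keeping the mass of the
half-line as a factor is what saves the `2` in the two-sided bound. -/
theorem gaussianReal_Ioi_le {c : ℝ} (hc : 0 ≤ c) :
    gaussianReal 0 1 (Set.Ioi c) ≤
      ENNReal.ofReal (Real.exp (-c ^ 2 / 2)) * gaussianReal 0 1 (Set.Ioi 0) := by
  rw [gaussianReal_apply 0 one_ne_zero, gaussianReal_apply 0 one_ne_zero,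
    ← lintegral_const_mul _ (measurable_gaussianPDF 0 1), ← lintegral_indicator measurableSet_Ioi,
    ← lintegral_indicator measurableSet_Ioi, ← lintegral_add_right_eq_self _ c]
  refine lintegral_mono fun x => ?_
  by_cases hx : 0 < x
  · rw [Set.indicator_of_mem (by simpa using hx), Set.indicator_of_mem (by simpa using hx),
      gaussianPDF, gaussianPDF, ← ENNReal.ofReal_mul (Real.exp_nonneg _)]
    refine ENNReal.ofReal_le_ofReal ?_
    simp only [gaussianPDFReal, NNReal.coe_one, mul_one, sub_zero]
    rw [mul_left_comm, ← Real.exp_add]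
    gcongr
    nlinarith
  · rw [Set.indicator_of_notMem (by simpa using hx)]
    exact zero_le

/-- The two-sided Gaussian tail bound without the factor `2`. -/
theorem gaussianReal_abs_gt_le {c : ℝ} (hc : 0 ≤ c) :
    gaussianReal 0 1 {x | c < |x|} ≤ ENNReal.ofReal (Real.exp (-c ^ 2 / 2)) := by
  have hneg : ∀ c : ℝ, gaussianReal 0 1 (Set.Iio (-c)) = gaussianReal 0 1 (Set.Ioi c) := by
    intro c
    have h := gaussianReal_map_neg (μ := 0) (v := 1)
    rw [neg_zero] at h
    nth_rewrite 1 [← h]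
    rw [Measure.map_apply measurable_neg measurableSet_Iio]
    congr 1
    ext x
    simp
  have hsub : {x : ℝ | c < |x|} ⊆ Set.Ioi c ∪ Set.Iio (-c) := by
    intro x hx
    have hx' : c < |x| := by simpa using hx
    rcases lt_abs.1 hx' with h | h
    · exact Or.inl h
    · exact Or.inr (show x < -c by linarith)
  calc gaussianReal 0 1 {x | c < |x|}
      ≤ gaussianReal 0 1 (Set.Ioi c) + gaussianReal 0 1 (Set.Iio (-c)) :=
        (measure_mono hsub).trans (measure_union_le _ _)
    _ = gaussianReal 0 1 (Set.Ioi c) + gaussianReal 0 1 (Set.Ioi c) := by rw [hneg]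
    _ ≤ ENNReal.ofReal (Real.exp (-c ^ 2 / 2)) *
        (gaussianReal 0 1 (Set.Ioi 0) + gaussianReal 0 1 (Set.Iio 0)) := by
        have h0 := hneg 0
        rw [neg_zero] at h0
        rw [mul_add, h0]
        exact add_le_add (gaussianReal_Ioi_le hc) (gaussianReal_Ioi_le hc)
    _ ≤ ENNReal.ofReal (Real.exp (-c ^ 2 / 2)) * 1 := by
        gcongr
        have hdisj : Disjoint (Set.Ioi (0 : ℝ)) (Set.Iio 0) :=
          Set.disjoint_left.2 fun x hx hx' =>
            lt_asymm (Set.mem_Ioi.1 hx) (Set.mem_Iio.1 hx')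
        rw [← measure_union hdisj measurableSet_Iio]
        exact prob_le_one
    _ = _ := mul_one _

theorem gaussianReal_sqrt_mul_sqrt_lt_abs_le {z : ℝ} (hz : 0 ≤ z) (v : ℝ≥0) :
    gaussianReal 0 v {x | √z * √v < |x|} ≤ ENNReal.ofReal (Real.exp (-z / 2)) := by
  have h := gaussianReal_map_const_mul (μ := 0) (v := 1) √v
  have hv : NNReal.mk (√v ^ 2) (sq_nonneg _) * 1 = v := by
    ext
    simp
  rw [mul_zero, hv] at h
  rw [← h, Measure.map_apply (by fun_prop) (measurableSet_lt (by fun_prop) (by fun_prop))]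
  have hsq : -√z ^ 2 / 2 = -z / 2 := by rw [Real.sq_sqrt hz]
  rw [← hsq]
  refine (measure_mono fun x hx => ?_).trans (gaussianReal_abs_gt_le (Real.sqrt_nonneg z))
  simp only [Set.mem_preimage, Set.mem_ofPred_eq, abs_mul, abs_of_nonneg (Real.sqrt_nonneg _)] at hx
  rw [mul_comm] at hx
  exact lt_of_mul_lt_mul_left hx (Real.sqrt_nonneg _)

/-- Tilting the density of rate `lam` by `exp (θ z)` yields a multiple of the density of rate `lam -
θ`. The parameter `θ` may be negative, as in the use with `θ = -1 / 2`. -/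
theorem lintegral_exp_expMeasure {lam θ : ℝ} (hlam : 0 < lam) (hθ : θ < lam) :
    ∫⁻ z, ENNReal.ofReal (Real.exp (θ * z)) ∂expMeasure lam =
      ENNReal.ofReal (lam / (lam - θ)) := by
  have hexp : expMeasure lam = volume.withDensity (exponentialPDF lam) := rfl
  have hd : 0 < lam - θ := by linarith
  have hm : ∀ r, Measurable (exponentialPDF r) := fun r =>
    (measurable_exponentialPDFReal r).ennreal_ofReal
  rw [hexp, lintegral_withDensity_eq_lintegral_mul _ (hm _) (by fun_prop),
    ← mul_one (ENNReal.ofReal (lam / (lam - θ))), ← lintegral_exponentialPDF_eq_one hd,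
    ← lintegral_const_mul _ (hm _)]
  refine lintegral_congr fun z => ?_
  rw [Pi.mul_apply, exponentialPDF_eq, exponentialPDF_eq]
  split_ifs with hz
  · rw [← ENNReal.ofReal_mul (by positivity), ← ENNReal.ofReal_mul (by positivity)]
    congr 1
    rw [mul_assoc, ← Real.exp_add, ← mul_assoc, div_mul_cancel₀ _ hd.ne']
    congr 2
    ring
  · simp

theorem lintegral_exp_shiftedExp {s lam θ : ℝ} (hlam : 0 < lam) (hθ : θ < lam) :
    ∫⁻ z, ENNReal.ofReal (Real.exp (θ * z)) ∂shiftedExp s lam =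
      ENNReal.ofReal (Real.exp (θ * s) * (lam / (lam - θ))) := by
  rw [shiftedExp_eq_map, lintegral_map (by fun_prop) (by fun_prop)]
  simp_rw [mul_add, Real.exp_add, ENNReal.ofReal_mul (Real.exp_nonneg (θ * s))]
  rw [lintegral_const_mul _ (by fun_prop), lintegral_exp_expMeasure hlam hθ]

theorem shiftedExp_Ioi {s lam u : ℝ} (hlam : 0 < lam) (hu : 0 ≤ u) :
    shiftedExp s lam (Set.Ioi (s + u)) = ENNReal.ofReal (Real.exp (-lam * u)) := by
  have := isProbabilityMeasure_expMeasure hlam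
  rw [shiftedExp_eq_map, Measure.map_apply (by fun_prop) measurableSet_Ioi]
  have h1 : (fun z => s + z) ⁻¹' Set.Ioi (s + u) = (Set.Iic u)ᶜ := by
    ext z; simp
  rw [h1, ← ofReal_measureReal, measureReal_compl measurableSet_Iic, probReal_univ]
  have := cdf_expMeasure_eq hlam u
  rw [cdf_eq_real, if_pos hu] at this
  rw [this]
  congr 1
  ring_nf

theorem shiftedExp_Iio (s lam : ℝ) : shiftedExp s lam (Set.Iio s) = 0 := by
  rw [shiftedExp, withDensity_apply _ measurableSet_Iio]
  refine (setLIntegral_congr_fun measurableSet_Iio fun z hz => ?_).trans lintegral_zero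
  rw [if_neg (not_le.2 hz), ENNReal.ofReal_zero]

/-- Chernoff's bound for the sum of independent shifted exponential variables of rate `1/2`. -/
theorem measure_sum_shiftedExp_ge_le {Ω : Type*} [MeasurableSpace Ω] {P : Measure Ω}
    [IsProbabilityMeasure P] {s : ℕ → ℝ} {ζ : ℕ → Ω → ℝ}
    (hlaw : ∀ n, HasLaw (ζ n) (shiftedExp (s n) (1 / 2)) P) (hind : iIndepFun ζ P)
    (T : ℕ) {v : ℝ} (hv : 1 ≤ v) :
    P {ω | ∑ n ∈ Finset.range T, s n + 2 * T * v ≤ ∑ n ∈ Finset.range T, ζ n ω} ≤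
      ENNReal.ofReal (Real.exp (-(T * (v - 1 - Real.log v)))) := by
  have hv0 : 0 < v := by linarith
  -- The optimal tilt, at which `1 / (1 - 2 θ) = v`.
  set θ : ℝ := (1 - v⁻¹) / 2 with hθdef
  have hvinv : v⁻¹ ≤ 1 := inv_le_one_of_one_le₀ hv
  have hvinv0 : 0 < v⁻¹ := inv_pos.2 hv0
  have hθ0 : 0 ≤ θ := by rw [hθdef]; linarith
  have hθ : θ < 1 / 2 := by rw [hθdef]; linarith
  have hquot : (1 / 2 : ℝ) / (1 / 2 - θ) = v := by
    rw [hθdef]; field_simp; ring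
  have hmgf : ∀ n, mgf (ζ n) P θ = Real.exp (θ * s n) * v := by
    intro n
    rw [mgf, integral_eq_lintegral_of_nonneg_ae
      (Filter.Eventually.of_forall fun _ => Real.exp_nonneg _)
      (by have := (hlaw n).aemeasurable; fun_prop),
      (hlaw n).lintegral_comp (f := fun z => ENNReal.ofReal (Real.exp (θ * z))) (by fun_prop),
      lintegral_exp_shiftedExp (by norm_num) hθ, hquot, ENNReal.toReal_ofReal (by positivity)]
  have hsum := hind.mgf_sum₀ (t := θ) (fun n => (hlaw n).aemeasurable) (Finset.range T)
  rw [Finset.prod_congr rfl fun n _ => hmgf n, Finset.prod_mul_distrib, ← Real.exp_sum,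
    ← Finset.mul_sum, Finset.prod_const, Finset.card_range] at hsum
  -- Without integrability `mgf` would take its default value `0`, but the product formula makes it
  -- positive.
  have hint : Integrable (fun ω => Real.exp (θ * (∑ n ∈ Finset.range T, ζ n) ω)) P := by
    by_contra h
    rw [mgf_undef h] at hsum
    exact (by positivity : (0 : ℝ) ≠ Real.exp (θ * ∑ n ∈ Finset.range T, s n) * v ^ T) hsum
  have h := measure_ge_le_exp_mul_mgf (∑ n ∈ Finset.range T, s n + 2 * T * v) hθ0 hint
  simp only [Finset.sum_apply] at h
  rw [← ofReal_measureReal]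
  refine ENNReal.ofReal_le_ofReal (h.trans (le_of_eq ?_))
  rw [hsum, ← Real.exp_log (pow_pos hv0 T), ← Real.exp_add, ← Real.exp_add, Real.log_pow]
  congr 1
  rw [hθdef]
  field_simp
  ring

end Tails

/-! ### Upper bound for the sum of the confidence parameters. -/

section ZetaSum

theorem exp_neg_log_tail {δ : ℝ} (hδ : 0 < δ) {T : ℕ} (hT : 1 ≤ T) :
    Real.exp (-Real.log (Real.pi ^ 2 * (T : ℝ) ^ 2 / (3 * δ))) =
      3 * δ / (Real.pi ^ 2 * (T : ℝ) ^ 2) := by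
  have hT' : (1 : ℝ) ≤ T := by exact_mod_cast hT
  rw [Real.exp_neg, Real.exp_log (by positivity), inv_div]

/-- With high probability the sum of the first `T` confidence parameters is at most
`T s_T + T + 2 √(T L) + 2 L`. -/
theorem measure_sum_zeta_gt_le {Ω : Type*} [MeasurableSpace Ω] {P : Measure Ω}
    [IsProbabilityMeasure P] {N : ℕ} (hN : 1 ≤ N) {δ : ℝ} (hδ : δ ∈ Set.Ioo (0 : ℝ) 1)
    {ζ : ℕ → Ω → ℝ}
    (hlaw : ∀ n, HasLaw (ζ n) (shiftedExp (shift N δ (n + 1)) (1 / 2)) P) (hind : iIndepFun ζ P)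
    {T : ℕ} (hT : 1 ≤ T) :
    P {ω | T * shift N δ T + T
        + 2 * √(T * Real.log (Real.pi ^ 2 * (T : ℝ) ^ 2 / (3 * δ)))
        + 2 * Real.log (Real.pi ^ 2 * (T : ℝ) ^ 2 / (3 * δ)) <
          ∑ n ∈ Finset.range T, ζ n ω} ≤
      ENNReal.ofReal (3 * δ / (Real.pi ^ 2 * (T : ℝ) ^ 2)) := by
  have hT' : (1 : ℝ) ≤ T := by exact_mod_cast hT
  have hT0 : (0 : ℝ) < T := by linarith
  rw [← exp_neg_log_tail hδ.1 hT]
  have hL0 := log_tail_nonneg hδ hT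
  set L := Real.log (Real.pi ^ 2 * (T : ℝ) ^ 2 / (3 * δ)) with hL
  obtain rfl | hT2 : T = 1 ∨ 2 ≤ T := by omega
  -- For `T = 1` the shifts give no slack, but the exact exponential tail is enough.
  · have hu : 0 ≤ 1 + 2 * √L + 2 * L := by positivity
    have hset : {ω | ((1 : ℕ) : ℝ) * shift N δ 1 + (1 : ℕ) + 2 * √((1 : ℕ) * L) + 2 * L <
        ∑ n ∈ Finset.range 1, ζ n ω} =
        {ω | shift N δ 1 + (1 + 2 * √L + 2 * L) < ζ 0 ω} := by
      ext ω
      simp [add_assoc]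
    rw [hset, (hlaw 0).measure_eq (p := fun z => shift N δ 1 + (1 + 2 * √L + 2 * L) < z)
      measurableSet_Ioi]
    change shiftedExp (shift N δ 1) (1 / 2) (Set.Ioi _) ≤ _
    rw [shiftedExp_Ioi (by norm_num) hu]
    refine ENNReal.ofReal_le_ofReal (Real.exp_le_exp.2 ?_)
    have := Real.sqrt_nonneg L
    linarith
  -- The quantity `2 T a` is the slack of `sum_shift`. With `r = √(L / T)`, the choice of `v` below
  -- makes the Chernoff threshold equal to the stated one.
  · set a : ℝ := 2 * (Real.log T - Real.log T.factorial / T) with ha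
    set r : ℝ := √(L / T) with hr
    have hr0 : 0 ≤ r := Real.sqrt_nonneg _
    have hr2 : T * r ^ 2 = L := by
      rw [hr, Real.sq_sqrt (by positivity)]; field_simp
    have hsqrt : √(T * L) = T * r := by
      rw [← hr2, show (T : ℝ) * (T * r ^ 2) = (T * r) ^ 2 by ring, Real.sqrt_sq (by positivity)]
    set v : ℝ := 1 / 2 + a + r + r ^ 2 with hv
    -- Chernoff's exponent must reach `L = T r²`, that is `v - 1 - log v ≥ r²`, which is `log v ≤ a
    -- - 1 / 2 + r`.
    have hmain : v ≤ Real.exp (a - 1 / 2 + r) ∧ 1 / 2 ≤ a := by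
      obtain rfl | hT3 : T = 2 ∨ 3 ≤ T := by omega
      · have : a = Real.log 2 := by rw [ha]; simp [Nat.factorial]; ring
        rw [hv, this]
        exact ⟨quadratic_le_exp_log_two hr0, by linarith [Real.log_two_gt_d9]⟩
      · have h1 := half_le_mul_log_sub_log_factorial hT3
        have h2 : 1 ≤ a := by
          have : a * T = 2 * (T * Real.log T - Real.log T.factorial) := by
            rw [ha]; field_simp
          nlinarith
        exact ⟨quadratic_le_exp_of_one_le h2 hr0, by linarith⟩
    have hv1 : 1 ≤ v := by nlinarith [hmain.2]
    have hlog : Real.log v ≤ a - 1 / 2 + r :=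
      (Real.log_le_iff_le_exp (by linarith)).2 hmain.1
    have h := measure_sum_shiftedExp_ge_le hlaw hind T hv1
    have hthr : ∑ n ∈ Finset.range T, shift N δ (n + 1) + 2 * T * v =
        T * shift N δ T + T + 2 * √(T * L) + 2 * L := by
      rw [sum_shift hN hδ.1 hT, hsqrt, hv, ← hr2, ha]
      field_simp
      ring
    rw [hthr] at h
    refine (measure_mono fun ω hω => ?_).trans (h.trans (ENNReal.ofReal_le_ofReal
      (Real.exp_le_exp.2 ?_)))
    · rw [Set.mem_ofPred_eq] at hω ⊢
      exact hω.le
    · rw [← hr2, neg_le_neg_iff]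
      refine mul_le_mul_of_nonneg_left ?_ hT0.le
      linarith

theorem hasSum_union_bound (δ : ℝ) :
    HasSum (fun n : ℕ => 3 * δ / (Real.pi ^ 2 * ((n + 1 : ℕ) : ℝ) ^ 2)) (δ / 2) := by
  have h := (hasSum_nat_add_iff' (f := fun n : ℕ => (1 : ℝ) / (n : ℝ) ^ 2) 1).2 hasSum_zeta_two
  have h2 := h.mul_left (3 * δ / Real.pi ^ 2)
  convert! h2 using 1
  · funext n
    field_simp
  · have := Real.pi_pos
    simp
    field_simp
    ring

theorem measure_iUnion_le_half {Ω : Type*} [MeasurableSpace Ω] {P : Measure Ω} {δ : ℝ}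
    (hδ : 0 < δ) {A : ℕ → Set Ω}
    (hA : ∀ n, P (A n) ≤ ENNReal.ofReal (3 * δ / (Real.pi ^ 2 * ((n + 1 : ℕ) : ℝ) ^ 2))) :
    P (⋃ n, A n) ≤ ENNReal.ofReal (δ / 2) := by
  have h := hasSum_union_bound δ
  calc P (⋃ n, A n) ≤ ∑' n, P (A n) := measure_iUnion_le _
    _ ≤ ∑' n : ℕ, ENNReal.ofReal (3 * δ / (Real.pi ^ 2 * ((n + 1 : ℕ) : ℝ) ^ 2)) :=
      ENNReal.tsum_le_tsum hA
    _ = ENNReal.ofReal (δ / 2) := by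
      rw [← ENNReal.ofReal_tsum_of_nonneg (fun n => by positivity) h.summable, h.tsum_eq]

end ZetaSum

/-! ### Concentration of the posterior -/

section Independence

variable {Ω α β γ : Type*} [MeasurableSpace Ω] [MeasurableSpace α] [MeasurableSpace β]
  [MeasurableSpace γ] {P : Measure Ω} [IsProbabilityMeasure P] {A : Ω → α} {B : Ω → β} {C : Ω → γ}

/-- Associativity of product measures. It separates the Gaussian part `(f, ε)` from `(ζ, U)`, given
the nested independences of `Model`. -/
theorem indepFun_prodMk_left (hA : AEMeasurable A P) (hB : AEMeasurable B P)
    (hC : AEMeasurable C P) (h : IndepFun A (fun ω => (B ω, C ω)) P) (hBC : IndepFun B C P) :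
    IndepFun (fun ω => (A ω, B ω)) C P := by
  have hAB : IndepFun A B P := h.comp measurable_id measurable_fst
  have h1 := (indepFun_iff_map_prod_eq_prod_map_map hA (hB.prodMk hC)).1 h
  rw [(indepFun_iff_map_prod_eq_prod_map_map hB hC).1 hBC, ← Measure.prodAssoc_prod,
    ← (indepFun_iff_map_prod_eq_prod_map_map hA hB).1 hAB] at h1
  rw [indepFun_iff_map_prod_eq_prod_map_map (hA.prodMk hB) hC]
  apply MeasurableEquiv.prodAssoc.map_measurableEquiv_injective
  rw [← h1, AEMeasurable.map_map_of_aemeasurable (by fun_prop) ((hA.prodMk hB).prodMk hC)]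
  rfl

theorem indepFun_prodMk_right (hA : AEMeasurable A P) (hB : AEMeasurable B P)
    (hC : AEMeasurable C P) (h : IndepFun (fun ω => (A ω, B ω)) C P) (hAB : IndepFun A B P) :
    IndepFun A (fun ω => (B ω, C ω)) P := by
  have hBC : IndepFun B C P := h.comp measurable_snd measurable_id
  have h1 := (indepFun_iff_map_prod_eq_prod_map_map (hA.prodMk hB) hC).1 h
  rw [(indepFun_iff_map_prod_eq_prod_map_map hA hB).1 hAB] at h1
  rw [indepFun_iff_map_prod_eq_prod_map_map hA (hB.prodMk hC),
    (indepFun_iff_map_prod_eq_prod_map_map hB hC).1 hBC, ← Measure.prodAssoc_prod, ← h1,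
    AEMeasurable.map_map_of_aemeasurable (by fun_prop) ((hA.prodMk hB).prodMk hC)]
  rfl

end Independence

/-! ### Law and independence of the posterior error for a fixed design. -/

section FixedDesign

variable {Ω X Ξ : Type*} [MeasurableSpace Ω] [MeasurableSpace Ξ] {P : Measure Ω}
  {k : X → X → ℝ} {σ : ℝ} {s : ℕ → ℝ} {lam : ℝ} {f : X → Ω → ℝ} {ε ζ : ℕ → Ω → ℝ} {U : Ω → Ξ}

/-- The noisy observations at the points of a fixed design. -/
def designObs (f : X → Ω → ℝ) (ε : ℕ → Ω → ℝ) {n : ℕ} (a : Fin n → X) (i : Fin n) (ω : Ω) : ℝ :=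
  f (a i) ω + ε i ω

/-- The error of the posterior mean at `x` for a fixed design. -/
noncomputable def designError (k : X → X → ℝ) (σ : ℝ) (f : X → Ω → ℝ) (ε : ℕ → Ω → ℝ) {n : ℕ}
    (a : Fin n → X) (x : X) (ω : Ω) : ℝ :=
  f x ω - ∑ i, postWeight k σ a x i * designObs f ε a i ω

namespace Model

theorem aemeasurable_noise (h : Model P k σ s lam f ε ζ U) :
    AEMeasurable (fun ω n => ε n ω) P :=
  aemeasurable_pi_lambda _ fun n => (h.noise_law n).aemeasurable

theorem aemeasurable_zeta (h : Model P k σ s lam f ε ζ U) : AEMeasurable (fun ω n => ζ n ω) P :=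
  aemeasurable_pi_lambda _ fun n => (h.zeta_law n).aemeasurable

theorem hasGaussianLaw_noise (h : Model P k σ s lam f ε ζ U) (n : ℕ) :
    HasGaussianLaw (fun ω (i : Fin n) => ε i ω) P :=
  (h.noise_indep.precomp Fin.val_injective).hasGaussianLaw fun i => (h.noise_law i).hasGaussianLaw

theorem indepFun_f_noise (h : Model P k σ s lam f ε ζ U) :
    IndepFun (fun ω x => f x ω) (fun ω n => ε n ω) P :=
  h.indep_f.comp measurable_id measurable_fst

theorem memLp_f (h : Model P k σ s lam f ε ζ U) (x : X) : MemLp (f x) 2 P :=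
  (h.gaussian.hasGaussianLaw_eval x).memLp_two

theorem memLp_noise (h : Model P k σ s lam f ε ζ U) (n : ℕ) : MemLp (ε n) 2 P :=
  (h.noise_law n).hasGaussianLaw.memLp_two

theorem memLp_designObs (h : Model P k σ s lam f ε ζ U) {n : ℕ} (a : Fin n → X) (i : Fin n) :
    MemLp (designObs f ε a i) 2 P :=
  (h.memLp_f _).add (h.memLp_noise _)

theorem memLp_designError (h : Model P k σ s lam f ε ζ U) {n : ℕ} (a : Fin n → X) (x : X) :
    MemLp (designError k σ f ε a x) 2 P :=
  (h.memLp_f x).sub (memLp_finsetSum _ fun i _ => (h.memLp_designObs a i).const_mul _)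

theorem cov_f_noise (h : Model P k σ s lam f ε ζ U) (x : X) (n : ℕ) : cov[f x, ε n; P] = 0 :=
  IndepFun.covariance_eq_zero
    (h.indepFun_f_noise.comp (measurable_pi_apply x) (measurable_pi_apply n))
    (h.memLp_f x) (h.memLp_noise n)

theorem cov_noise (h : Model P k σ s lam f ε ζ U) (i j : ℕ) :
    cov[ε i, ε j; P] = if i = j then σ ^ 2 else 0 := by
  split_ifs with hij
  · subst hij
    rw [covariance_self (h.noise_law i).aemeasurable, (h.noise_law i).variance_eq,
      variance_id_gaussianReal, Real.coe_toNNReal _ (sq_nonneg σ)]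
  · exact (h.noise_indep.indepFun hij).covariance_eq_zero (h.memLp_noise i) (h.memLp_noise j)

section FiniteDomain

variable [Fintype X]

theorem aemeasurable_f (h : Model P k σ s lam f ε ζ U) : AEMeasurable (fun ω x => f x ω) P :=
  aemeasurable_pi_lambda _ fun x => h.gaussian.aemeasurable x

theorem hasGaussianLaw_f (h : Model P k σ s lam f ε ζ U) :
    HasGaussianLaw (fun ω x => f x ω) P := by
  let L : ({x // x ∈ (Finset.univ : Finset X)} → ℝ) →L[ℝ] (X → ℝ) :=
    ContinuousLinearMap.pi fun x => ContinuousLinearMap.proj ⟨x, Finset.mem_univ x⟩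
  exact (h.gaussian.hasGaussianLaw Finset.univ).map_fun L

theorem hasGaussianLaw_f_noise (h : Model P k σ s lam f ε ζ U) (n : ℕ) :
    HasGaussianLaw (fun ω => ((fun x => f x ω), fun i : Fin n => ε i ω)) P :=
  IndepFun.hasGaussianLaw h.hasGaussianLaw_f (h.hasGaussianLaw_noise n)
    (h.indepFun_f_noise.comp measurable_id
      (measurable_pi_lambda _ fun i : Fin n => measurable_pi_apply (i : ℕ)))

/-- Both components are linear in `(f, ε)`. Joint Gaussianity is what turns zero covariance into
independence; the index `Fin 1` presents the error as a family, as the criterion requires. -/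
theorem hasGaussianLaw_designError_designObs (h : Model P k σ s lam f ε ζ U) {n : ℕ}
    (a : Fin n → X) (x : X) :
    HasGaussianLaw (fun ω => ((fun _ : Fin 1 => designError k σ f ε a x ω),
      fun i => designObs f ε a i ω)) P := by
  let Lf : X → (X → ℝ) × (Fin n → ℝ) →L[ℝ] ℝ := fun x =>
    (ContinuousLinearMap.proj x).comp (ContinuousLinearMap.fst ℝ (X → ℝ) (Fin n → ℝ))
  let Ly : Fin n → (X → ℝ) × (Fin n → ℝ) →L[ℝ] ℝ := fun i => Lf (a i) +
    (ContinuousLinearMap.proj i).comp (ContinuousLinearMap.snd ℝ (X → ℝ) (Fin n → ℝ))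
  let LW : (X → ℝ) × (Fin n → ℝ) →L[ℝ] ℝ := Lf x - ∑ i, postWeight k σ a x i • Ly i
  let L : (X → ℝ) × (Fin n → ℝ) →L[ℝ] (Fin 1 → ℝ) × (Fin n → ℝ) :=
    (ContinuousLinearMap.pi fun _ => LW).prod (ContinuousLinearMap.pi Ly)
  have hL := (h.hasGaussianLaw_f_noise n).map_fun L
  have heq : (fun ω => ((fun _ : Fin 1 => designError k σ f ε a x ω),
      fun i => designObs f ε a i ω)) =
      fun ω => L ((fun x => f x ω), fun i : Fin n => ε i ω) := by
    funext ω
    refine Prod.ext (funext fun _ => ?_) (funext fun i => ?_)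
    · simp [L, LW, Ly, Lf, designError, designObs, mul_add]
    · simp [L, Ly, Lf, designObs]
  rw [heq]
  exact hL

end FiniteDomain

variable [IsProbabilityMeasure P]

theorem cov_f_designObs (h : Model P k σ s lam f ε ζ U) {n : ℕ} (a : Fin n → X) (x : X)
    (j : Fin n) : cov[f x, designObs f ε a j; P] = kernelVector k a x j := by
  change cov[f x, f (a j) + ε j; P] = k x (a j)
  rw [covariance_add_right (h.memLp_f _) (h.memLp_f _) (h.memLp_noise _), h.cov_eq,
    h.cov_f_noise, add_zero]

theorem cov_designObs (h : Model P k σ s lam f ε ζ U) {n : ℕ} (a : Fin n → X) (i j : Fin n) :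
    cov[designObs f ε a i, designObs f ε a j; P] = obsMatrix k σ a i j := by
  change cov[f (a i) + ε i, designObs f ε a j; P] = _
  rw [covariance_add_left (h.memLp_f _) (h.memLp_noise _) (h.memLp_designObs a j),
    h.cov_f_designObs]
  change _ + cov[ε i, f (a j) + ε j; P] = _
  rw [covariance_add_right (h.memLp_noise _) (h.memLp_f _) (h.memLp_noise _), h.cov_noise,
    covariance_comm, h.cov_f_noise, zero_add]
  simp [obsMatrix, kernelMatrix, kernelVector, Matrix.one_apply, Fin.ext_iff]

theorem cov_designError_left (h : Model P k σ s lam f ε ζ U) {n : ℕ} (a : Fin n → X) (x : X)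
    {Z : Ω → ℝ} (hZ : MemLp Z 2 P) :
    cov[designError k σ f ε a x, Z; P] =
      cov[f x, Z; P] - ∑ i, postWeight k σ a x i * cov[designObs f ε a i, Z; P] := by
  have hterm : ∀ i, MemLp (fun ω => postWeight k σ a x i * designObs f ε a i ω) 2 P := fun i =>
    (h.memLp_designObs a i).const_mul _
  change cov[fun ω => f x ω - ∑ i, postWeight k σ a x i * designObs f ε a i ω, Z; P] = _
  rw [covariance_fun_sub_left (h.memLp_f x) (memLp_finsetSum _ fun i _ => hterm i) hZ,
    covariance_fun_sum_left hterm hZ]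
  simp_rw [covariance_const_mul_left]

theorem integral_designError (h : Model P k σ s lam f ε ζ U) {n : ℕ} (a : Fin n → X) (x : X) :
    ∫ ω, designError k σ f ε a x ω ∂P = 0 := by
  have hnoise : ∀ n, ∫ ω, ε n ω ∂P = 0 := fun n => by
    rw [(h.noise_law n).integral_eq, integral_id_gaussianReal]
  have hobs : ∀ i, ∫ ω, designObs f ε a i ω ∂P = 0 := fun i => by
    change ∫ ω, (f (a i) ω + ε i ω) ∂P = 0
    rw [integral_add ((h.memLp_f _).integrable (by norm_num))
      ((h.memLp_noise _).integrable (by norm_num)), h.mean_zero, hnoise, add_zero]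
  have hint : ∀ i, Integrable (fun ω => postWeight k σ a x i * designObs f ε a i ω) P := fun i =>
    ((h.memLp_designObs a i).integrable (by norm_num)).const_mul _
  change ∫ ω, (f x ω - ∑ i, postWeight k σ a x i * designObs f ε a i ω) ∂P = 0
  rw [integral_sub ((h.memLp_f _).integrable (by norm_num))
      (integrable_finsetSum _ fun i _ => hint i), integral_finsetSum _ fun i _ => hint i, h.mean_zero]
  simp [integral_const_mul, hobs]

variable [Fintype X]

/-- These are the normal equations `(K + σ² I) w = k(x)` satisfied by the posterior weights. -/
theorem cov_designError_designObs (h : Model P k σ s lam f ε ζ U)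
    (hk : (Matrix.of k).PosSemidef) (hσ : 0 < σ) {n : ℕ} (a : Fin n → X) (x : X) (j : Fin n) :
    cov[designError k σ f ε a x, designObs f ε a j; P] = 0 := by
  rw [h.cov_designError_left a x (h.memLp_designObs a j), h.cov_f_designObs]
  simp_rw [h.cov_designObs, mul_comm (postWeight k σ a x _)]
  have hsymm : ∀ i, obsMatrix k σ a i j = obsMatrix k σ a j i := fun i => by
    simpa using (congrFun (congrFun (obsMatrix_posDef hk hσ a).isHermitian.eq i) j).symm
  have := congrFun (obsMatrix_mulVec_postWeight hk hσ a x) j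
  simp_rw [hsymm]
  rw [sub_eq_zero]
  exact this.symm

/-- The error is orthogonal to the observations, so its variance is its covariance with `f x`. -/
theorem variance_designError (h : Model P k σ s lam f ε ζ U)
    (hk : (Matrix.of k).PosSemidef) (hσ : 0 < σ) {n : ℕ} (D : Fin n → X × ℝ) (x : X) :
    Var[designError k σ f ε (fun i => (D i).1) x; P] = postVar k σ D x := by
  set a : Fin n → X := fun i => (D i).1 with ha
  have hW := h.memLp_designError a x
  rw [← covariance_self hW.aemeasurable, h.cov_designError_left a x hW]
  have h0 : ∀ i, cov[designObs f ε a i, designError k σ f ε a x; P] = 0 := fun i => by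
    rw [covariance_comm, h.cov_designError_designObs hk hσ]
  simp only [h0, mul_zero, Finset.sum_const_zero, sub_zero]
  rw [covariance_comm, h.cov_designError_left a x (h.memLp_f x), h.cov_eq, postVar_eq]
  congr 1
  refine Finset.sum_congr rfl fun i _ => ?_
  rw [covariance_comm, h.cov_f_designObs, mul_comm]

theorem postVar_nonneg (h : Model P k σ s lam f ε ζ U)
    (hk : (Matrix.of k).PosSemidef) (hσ : 0 < σ) {n : ℕ} (D : Fin n → X × ℝ) (x : X) :
    0 ≤ postVar k σ D x := by
  rw [← h.variance_designError hk hσ D x]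
  exact variance_nonneg _ _

theorem map_designError (h : Model P k σ s lam f ε ζ U) (hk : (Matrix.of k).PosSemidef)
    (hσ : 0 < σ) {n : ℕ} (D : Fin n → X × ℝ) (x : X) :
    P.map (designError k σ f ε (fun i => (D i).1) x) =
      gaussianReal 0 (postVar k σ D x).toNNReal := by
  have hW : HasGaussianLaw (designError k σ f ε (fun i => (D i).1) x) P :=
    (h.hasGaussianLaw_designError_designObs (fun i => (D i).1) x).fst.eval 0
  rw [hW.map_eq_gaussianReal, h.integral_designError, h.variance_designError hk hσ]

/-- The posterior error for a fixed design is independent of the observations, the confidence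
parameters and the tie-breaking randomness. -/
theorem indepFun_designError (h : Model P k σ s lam f ε ζ U) (hk : (Matrix.of k).PosSemidef)
    (hσ : 0 < σ) {n : ℕ} (a : Fin n → X) (x : X) :
    IndepFun (designError k σ f ε a x)
      (fun ω => ((fun i => designObs f ε a i ω), (fun n => ζ n ω), U ω)) P := by
  have hG := h.hasGaussianLaw_designError_designObs (k := k) (σ := σ) a x
  have h1 : IndepFun (designError k σ f ε a x) (fun ω i => designObs f ε a i ω) P :=
    (hG.indepFun_of_covariance_eval (X := fun _ : Fin 1 => designError k σ f ε a x)
      fun _ j => h.cov_designError_designObs hk hσ a x j).comp (measurable_pi_apply 0)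
      measurable_id
  have hrest : AEMeasurable (fun ω => ((fun n => ζ n ω), U ω)) P :=
    h.aemeasurable_zeta.prodMk h.tie_aemeasurable
  have h2 := indepFun_prodMk_left h.aemeasurable_f h.aemeasurable_noise hrest h.indep_f
    h.indep_noise
  have hφ : Measurable fun p : (X → ℝ) × (ℕ → ℝ) =>
      (p.1 x - ∑ i, postWeight k σ a x i * (p.1 (a i) + p.2 i),
        fun i : Fin n => p.1 (a i) + p.2 i) := by fun_prop
  exact indepFun_prodMk_right (h.memLp_designError a x).aemeasurable hG.snd.aemeasurable hrest
    (h2.comp hφ measurable_id) h1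

end Model

end FixedDesign

/-! ### From fixed designs to the adaptive algorithm. -/

section AdaptiveDesign

variable {Ω X Ξ : Type*} {f : X → Ω → ℝ} {ε ζ : ℕ → Ω → ℝ} {U : Ω → Ξ}
  {sel : ∀ n : ℕ, (Fin n → X × ℝ) → ℝ → Ξ → X} {x : ℕ → Ω → X} {y : ℕ → Ω → ℝ}

/-- The observations, confidence parameters and tie-breaking randomness for which the algorithm
queries the points of the design `a`. -/
def designSet (sel : ∀ n : ℕ, (Fin n → X × ℝ) → ℝ → Ξ → X) {n : ℕ} (a : Fin n → X) :
    Set ((Fin n → ℝ) × (ℕ → ℝ) × Ξ) :=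
  {p | ∀ i : Fin n, sel i
    (fun j : Fin i => (a (Fin.castLE i.2.le j), p.1 (Fin.castLE i.2.le j)))
    (p.2.1 i) p.2.2 = a i}

theorem measurableSet_designSet [MeasurableSpace X] [MeasurableSingletonClass X]
    [MeasurableSpace Ξ] {k : X → X → ℝ} {σ : ℝ} (hsel : IsSelectionRule k σ sel) {n : ℕ}
    (a : Fin n → X) : MeasurableSet (designSet sel a) := by
  have : designSet sel a = ⋂ i : Fin n, {p | sel i
      (fun j : Fin i => (a (Fin.castLE i.2.le j), p.1 (Fin.castLE i.2.le j)))
      (p.2.1 i) p.2.2 = a i} := by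
    ext p; simp [designSet]
  rw [this]
  refine MeasurableSet.iInter fun i => ?_
  have hm : Measurable fun p : (Fin n → ℝ) × (ℕ → ℝ) × Ξ =>
      ((fun j : Fin i => (a (Fin.castLE i.2.le j), p.1 (Fin.castLE i.2.le j))),
        p.2.1 (i : ℕ), p.2.2) := by fun_prop
  exact ((hsel.measurable i).comp hm) (measurableSet_singleton (a i))

theorem IsRun.data_eq (hrun : IsRun sel f ε ζ U x y) {n : ℕ} {a : Fin n → X} {ω : Ω} {m : ℕ}
    (hm : m ≤ n) (h : ∀ i : Fin n, (i : ℕ) < m → x i ω = a i) :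
    (fun j : Fin m => (x j ω, y j ω)) =
      fun j : Fin m => (a (Fin.castLE hm j), designObs f ε a (Fin.castLE hm j) ω) := by
  funext j
  have hj : x j ω = a (Fin.castLE hm j) := h (Fin.castLE hm j) j.2
  rw [hrun.observe, hj]
  rfl

/-- This makes the event that the run follows `a` depend only on variables independent of the
posterior error for `a`. By strong induction, agreement in earlier rounds makes the actual history
equal to that of the fixed design. -/
theorem IsRun.query_eq_iff (hrun : IsRun sel f ε ζ U x y) {n : ℕ} (a : Fin n → X) (ω : Ω) :
    ((fun i => designObs f ε a i ω), (fun n => ζ n ω), U ω) ∈ designSet sel a ↔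
      a = fun i : Fin n => x i ω := by
  constructor
  · intro h
    have key : ∀ m : ℕ, ∀ hm : m < n, x m ω = a ⟨m, hm⟩ := by
      intro m
      induction m using Nat.strong_induction_on with
      | _ m ih =>
        intro hm
        rw [hrun.query, hrun.data_eq hm.le fun i hi => ih i hi i.2]
        exact h ⟨m, hm⟩
    funext i
    exact (key i i.2).symm
  · intro h i
    have hi : x i ω = a i := by rw [h]
    rw [← hi, hrun.query, hrun.data_eq (a := a) i.2.le fun j _ => by rw [h]]

variable [MeasurableSpace Ω] [MeasurableSpace Ξ] [Fintype X] {P : Measure Ω}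
  [IsProbabilityMeasure P] {k : X → X → ℝ} {σ : ℝ} {s : ℕ → ℝ} {lam : ℝ}

theorem gaussianReal_sqrt_mul_sqrt_lt_abs_le_exp (z : ℝ) (v : ℝ≥0) :
    gaussianReal 0 v {w | √z * √v < |w|} ≤ ENNReal.ofReal (Real.exp (-z / 2)) := by
  -- For negative `z` the square root is `0`, but the right side is at least `1`.
  rcases le_total 0 z with hz | hz
  · exact gaussianReal_sqrt_mul_sqrt_lt_abs_le hz v
  · refine prob_le_one.trans ?_
    rw [← ENNReal.ofReal_one]
    exact ENNReal.ofReal_le_ofReal (Real.one_le_exp (by linarith))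

/-- By independence the joint law is a product, so the Gaussian tail bound applies with the
observations, `ζ` and `U` frozen, even when `ζ n` sets the width and `S` restricts them. -/
theorem Model.measure_designError_gt_le (h : Model P k σ s lam f ε ζ U)
    (hk : (Matrix.of k).PosSemidef) (hσ : 0 < σ) {n : ℕ} (D : Fin n → X × ℝ) (x' : X)
    {S : Set ((Fin n → ℝ) × (ℕ → ℝ) × Ξ)} (hS : MeasurableSet S) :
    P {ω | ((fun i => designObs f ε (fun i => (D i).1) i ω), (fun n => ζ n ω), U ω) ∈ S ∧
        √(ζ n ω) * √(postVar k σ D x') < |designError k σ f ε (fun i => (D i).1) x' ω|} ≤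
      ∫⁻ ω, S.indicator (fun p => ENNReal.ofReal (Real.exp (-(p.2.1 n) / 2)))
        ((fun i => designObs f ε (fun i => (D i).1) i ω), (fun n => ζ n ω), U ω) ∂P := by
  set a : Fin n → X := fun i => (D i).1
  set W := designError k σ f ε a x'
  let V : Ω → (Fin n → ℝ) × (ℕ → ℝ) × Ξ := fun ω =>
    ((fun i => designObs f ε a i ω), (fun n => ζ n ω), U ω)
  have hW : AEMeasurable W P := (h.memLp_designError a x').aemeasurable
  have hV : AEMeasurable V P :=
    (aemeasurable_pi_lambda _ fun i => (h.memLp_designObs a i).aemeasurable).prodMk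
      (h.aemeasurable_zeta.prodMk h.tie_aemeasurable)
  have : IsProbabilityMeasure (P.map V) := Measure.isProbabilityMeasure_map hV
  set v : ℝ≥0 := (postVar k σ D x').toNNReal with hv
  have hvv : (v : ℝ) = postVar k σ D x' := Real.coe_toNNReal _ (h.postVar_nonneg hk hσ D x')
  let B : Set (ℝ × ((Fin n → ℝ) × (ℕ → ℝ) × Ξ)) := {q | q.2 ∈ S ∧ √(q.2.2.1 n) * √v < |q.1|}
  have hB : MeasurableSet B := by
    have h1 : Measurable fun q : ℝ × ((Fin n → ℝ) × (ℕ → ℝ) × Ξ) => q.2.2.1 n := by fun_prop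
    have h2 : B = Prod.snd ⁻¹' S ∩ {q | √(q.2.2.1 n) * √v < |q.1|} := by
      ext q; simp [B]
    rw [h2]
    exact (measurable_snd hS).inter
      (measurableSet_lt (h1.sqrt.mul_const _) measurable_fst.abs)
  have hG : Measurable fun p : (Fin n → ℝ) × (ℕ → ℝ) × Ξ =>
      ENNReal.ofReal (Real.exp (-(p.2.1 n) / 2)) := by fun_prop
  have h1 : P {ω | V ω ∈ S ∧ √(ζ n ω) * √(postVar k σ D x') < |W ω|} =
      P.map (fun ω => (W ω, V ω)) B := by
    rw [Measure.map_apply_of_aemeasurable (hW.prodMk hV) hB, ← hvv]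
    rfl
  have h2 : P.map (fun ω => (W ω, V ω)) = (gaussianReal 0 v).prod (P.map V) := by
    rw [hv, ← h.map_designError hk hσ D x']
    exact (indepFun_iff_map_prod_eq_prod_map_map hW hV).1 (h.indepFun_designError hk hσ a x')
  change P {ω | V ω ∈ S ∧ √(ζ n ω) * √(postVar k σ D x') < |W ω|} ≤
    ∫⁻ ω, S.indicator (fun p => ENNReal.ofReal (Real.exp (-(p.2.1 n) / 2))) (V ω) ∂P
  rw [h1, h2, Measure.prod_apply_symm hB, ← lintegral_map' (hG.indicator hS).aemeasurable hV]
  refine lintegral_mono fun p => ?_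
  by_cases hp : p ∈ S
  · rw [Set.indicator_of_mem hp]
    refine le_trans (measure_mono fun w hw => ?_)
      (gaussianReal_sqrt_mul_sqrt_lt_abs_le_exp (p.2.1 n) v)
    exact hw.2
  · rw [Set.indicator_of_notMem hp]
    refine le_of_eq ?_
    have : (fun w => (w, p)) ⁻¹' B = ∅ := by
      ext w
      simp [B, hp]
    rw [this, measure_empty]

/-- The posterior confidence interval at a point fails with probability at most the mean of
`exp (-ζ / 2)`, although the design is adaptive. -/
theorem Model.measure_confidence_fail_le [MeasurableSpace X] [MeasurableSingletonClass X]
    (h : Model P k σ s lam f ε ζ U) (hk : (Matrix.of k).PosSemidef) (hσ : 0 < σ)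
    (hsel : IsSelectionRule k σ sel) (hrun : IsRun sel f ε ζ U x y) (n : ℕ) (x' : X) :
    P {ω | √(ζ n ω) * √(postVar k σ (fun i : Fin n => (x i ω, y i ω)) x') <
        |f x' ω - postMean k σ (fun i : Fin n => (x i ω, y i ω)) x'|} ≤
      ∫⁻ ω, ENNReal.ofReal (Real.exp (-(ζ n ω) / 2)) ∂P := by
  classical
  let V : (Fin n → X) → Ω → (Fin n → ℝ) × (ℕ → ℝ) × Ξ := fun a ω =>
    ((fun i => designObs f ε a i ω), (fun n => ζ n ω), U ω)
  let G : (Fin n → ℝ) × (ℕ → ℝ) × Ξ → ℝ≥0∞ := fun p =>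
    ENNReal.ofReal (Real.exp (-(p.2.1 n) / 2))
  have hG : Measurable G := by fun_prop
  have hV : ∀ a, AEMeasurable (V a) P := fun a =>
    (aemeasurable_pi_lambda _ fun i => (h.memLp_designObs a i).aemeasurable).prodMk
      (h.aemeasurable_zeta.prodMk h.tie_aemeasurable)
  -- The observed values are set to `0` because the posterior variance ignores them.
  let Bad : (Fin n → X) → Set Ω := fun a => {ω | V a ω ∈ designSet sel a ∧
    √(ζ n ω) * √(postVar k σ (fun i => (a i, (0 : ℝ))) x') < |designError k σ f ε a x' ω|}
  have hsub : {ω | √(ζ n ω) * √(postVar k σ (fun i : Fin n => (x i ω, y i ω)) x') <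
      |f x' ω - postMean k σ (fun i : Fin n => (x i ω, y i ω)) x'|} ⊆ ⋃ a, Bad a := by
    intro ω hω
    rw [Set.mem_ofPred_eq] at hω
    refine Set.mem_iUnion.2 ⟨fun i => x i ω, (hrun.query_eq_iff _ ω).2 rfl, ?_⟩
    rw [hrun.data_eq (a := fun i : Fin n => x i ω) le_rfl fun i _ => rfl,
      postMean_eq hk hσ] at hω
    exact hω
  calc P {ω | √(ζ n ω) * √(postVar k σ (fun i : Fin n => (x i ω, y i ω)) x') <
        |f x' ω - postMean k σ (fun i : Fin n => (x i ω, y i ω)) x'|}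
      ≤ ∑ a, P (Bad a) := (measure_mono hsub).trans (measure_iUnion_fintype_le _ _)
    _ ≤ ∑ a, ∫⁻ ω, (designSet sel a).indicator G (V a ω) ∂P :=
        Finset.sum_le_sum fun a _ => h.measure_designError_gt_le hk hσ (fun i => (a i, (0 : ℝ))) x'
          (measurableSet_designSet hsel a)
    _ = ∫⁻ ω, ∑ a, (designSet sel a).indicator G (V a ω) ∂P :=
        (lintegral_finsetSum' _ fun a _ =>
          (hG.indicator (measurableSet_designSet hsel a)).comp_aemeasurable (hV a)).symm
    _ = ∫⁻ ω, ENNReal.ofReal (Real.exp (-(ζ n ω) / 2)) ∂P := by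
        -- For each `ω` exactly one design is realised, so the union over designs costs no factor.
        refine lintegral_congr fun ω => ?_
        have : ∀ a, (designSet sel a).indicator G (V a ω) =
            if a = (fun i : Fin n => x i ω) then ENNReal.ofReal (Real.exp (-(ζ n ω) / 2)) else 0 := by
          intro a
          by_cases ha : a = fun i : Fin n => x i ω
          · rw [if_pos ha, Set.indicator_of_mem ((hrun.query_eq_iff a ω).2 ha)]
          · rw [if_neg ha, Set.indicator_of_notMem fun h => ha ((hrun.query_eq_iff a ω).1 h)]
        simp_rw [this]
        simp

end AdaptiveDesign

/-! ### The regret bound -/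

section Regret

variable {Ω X Ξ : Type*} {f : X → Ω → ℝ} {ε ζ : ℕ → Ω → ℝ} {U : Ω → Ξ}
  {sel : ∀ n : ℕ, (Fin n → X × ℝ) → ℝ → Ξ → X} {x : ℕ → Ω → X} {y : ℕ → Ω → ℝ}
  {k : X → X → ℝ} {σ : ℝ}

section Zeta

variable [MeasurableSpace Ω] [MeasurableSpace Ξ] {P : Measure Ω}

/-- The exponential part contributes `(1 / 2) / (1 / 2 + 1 / 2) = 1 / 2` and the shift `exp (-s / 2)
= 6 δ / (N t² π²)`. -/
theorem Model.lintegral_exp_neg_half_zeta {N : ℕ} {δ : ℝ} (hN : 1 ≤ N) (hδ : 0 < δ)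
    (h : Model P k σ (shift N δ) (1 / 2) f ε ζ U) (n : ℕ) :
    N * ∫⁻ ω, ENNReal.ofReal (Real.exp (-(ζ n ω) / 2)) ∂P =
      ENNReal.ofReal (3 * δ / (Real.pi ^ 2 * ((n + 1 : ℕ) : ℝ) ^ 2)) := by
  have hN' : (1 : ℝ) ≤ N := by exact_mod_cast hN
  have h1 := (h.zeta_law n).lintegral_comp (f := fun z => ENNReal.ofReal (Real.exp (-1 / 2 * z)))
    (by fun_prop)
  rw [lintegral_exp_shiftedExp (by norm_num) (by norm_num)] at h1
  have h2 : ∀ ω, -(ζ n ω) / 2 = -1 / 2 * ζ n ω := fun ω => by ring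
  simp_rw [h2, h1]
  rw [← ENNReal.ofReal_natCast, ← ENNReal.ofReal_mul (by positivity), shift]
  congr 1
  have h3 : -1 / 2 * (2 * Real.log (N * ((n + 1 : ℕ) : ℝ) ^ 2 * Real.pi ^ 2 / (6 * δ))) =
      -Real.log (N * ((n + 1 : ℕ) : ℝ) ^ 2 * Real.pi ^ 2 / (6 * δ)) := by ring
  rw [h3, Real.exp_neg, Real.exp_log (by positivity)]
  field_simp
  norm_num

theorem Model.ae_zeta_nonneg {N : ℕ} {δ : ℝ} (hN : 1 ≤ N) (hδ : δ ∈ Set.Ioo (0 : ℝ) 1)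
    (h : Model P k σ (shift N δ) (1 / 2) f ε ζ U) (n : ℕ) : P {ω | ζ n ω < 0} = 0 := by
  rw [(h.zeta_law n).measure_eq (p := fun z => z < 0) measurableSet_Iio]
  have hs := shift_lower_bound hN hδ (Nat.le_add_left 1 n)
  refine measure_mono_null ?_ (shiftedExp_Iio (shift N δ (n + 1)) (1 / 2))
  intro z hz
  rw [Set.mem_ofPred_eq] at hz
  exact Set.mem_Iio.2 (by linarith)

end Zeta

variable [Fintype X]

/-- If all confidence intervals of round `n` are valid, then the instantaneous regret is at most
twice the width of the confidence interval at the queried point. -/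
theorem regret_le_of_confidence [Nonempty X] [MeasurableSpace X] [MeasurableSpace Ξ]
    (hsel : IsSelectionRule k σ sel) (hrun : IsRun sel f ε ζ U x y) {n : ℕ} {ω : Ω}
    (hconf : ∀ x', |f x' ω - postMean k σ (fun i : Fin n => (x i ω, y i ω)) x'| ≤
      √(ζ n ω) * √(postVar k σ (fun i : Fin n => (x i ω, y i ω)) x')) :
    (⨆ x', f x' ω) - f (x n ω) ω ≤
      2 * (√(ζ n ω) * √(postVar k σ (fun i : Fin n => (x i ω, y i ω)) (x n ω))) := by
  obtain ⟨b, hb⟩ := exists_eq_ciSup_of_finite (f := fun x' => f x' ω)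
  have h1 := hsel.argmax n (fun i : Fin n => (x i ω, y i ω)) (ζ n ω) (U ω) b
  rw [← hrun.query n ω, ucb, ucb] at h1
  have h2 := (abs_le.1 (hconf b)).2
  have h3 := (abs_le.1 (hconf (x n ω))).1
  rw [← hb]
  linarith

/-- Cauchy-Schwarz over the rounds; it needs `ζ ≥ 0`, which holds almost surely because the shifts
are positive. -/
theorem cumRegret_le_regretBound [Nonempty X] [MeasurableSpace X] [MeasurableSpace Ξ]
    (hk : (Matrix.of k).PosSemidef) (hk_le : ∀ x, k x x ≤ 1) (hσ : 0 < σ) {δ : ℝ}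
    (hsel : IsSelectionRule k σ sel) (hrun : IsRun sel f ε ζ U x y) {ω : Ω}
    (hvar : ∀ n, 0 ≤ postVar k σ (fun i : Fin n => (x i ω, y i ω)) (x n ω))
    (hζ : ∀ n, 0 ≤ ζ n ω)
    (hconf : ∀ n x', |f x' ω - postMean k σ (fun i : Fin n => (x i ω, y i ω)) x'| ≤
      √(ζ n ω) * √(postVar k σ (fun i : Fin n => (x i ω, y i ω)) x')) {T : ℕ}
    (hsum : ∑ n ∈ Finset.range T, ζ n ω ≤ T * shift (Fintype.card X) δ T + T
      + 2 * √(T * Real.log (Real.pi ^ 2 * (T : ℝ) ^ 2 / (3 * δ)))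
      + 2 * Real.log (Real.pi ^ 2 * (T : ℝ) ^ 2 / (3 * δ))) :
    cumRegret f x T ω ≤ regretBound k σ δ T := by
  have hpv := sum_postVar_le hk hk_le hσ (fun n => x n ω) (fun n => y n ω) hvar T
  calc cumRegret f x T ω
      ≤ ∑ n ∈ Finset.range T,
          2 * (√(ζ n ω) * √(postVar k σ (fun i : Fin n => (x i ω, y i ω)) (x n ω))) :=
        Finset.sum_le_sum fun n _ => regret_le_of_confidence hsel hrun (hconf n)
    _ ≤ 2 * (√(∑ n ∈ Finset.range T, ζ n ω) * √(∑ n ∈ Finset.range T,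
          postVar k σ (fun i : Fin n => (x i ω, y i ω)) (x n ω))) := by
        rw [← Finset.mul_sum]
        gcongr
        exact Real.sum_sqrt_mul_sqrt_le _ hζ hvar
    _ ≤ regretBound k σ δ T := by
        rw [← Real.sqrt_mul (Finset.sum_nonneg fun n _ => hζ n), regretBound, mul_comm (C₁ σ * _)]
        have h0 := Finset.sum_nonneg fun n (_ : n ∈ Finset.range T) => hζ n
        gcongr
        · exact Finset.sum_nonneg fun n _ => hvar n
        · exact h0.trans hsum

variable [MeasurableSpace Ω] [MeasurableSpace Ξ] {P : Measure Ω} [IsProbabilityMeasure P]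

theorem measure_confidence_fail_le [MeasurableSpace X] [MeasurableSingletonClass X] [Nonempty X]
    (hk : (Matrix.of k).PosSemidef) (hσ : 0 < σ) {δ : ℝ} (hδ : δ ∈ Set.Ioo (0 : ℝ) 1)
    (h : Model P k σ (shift (Fintype.card X) δ) (1 / 2) f ε ζ U)
    (hsel : IsSelectionRule k σ sel) (hrun : IsRun sel f ε ζ U x y) (n : ℕ) :
    P {ω | ∃ x', √(ζ n ω) * √(postVar k σ (fun i : Fin n => (x i ω, y i ω)) x') <
        |f x' ω - postMean k σ (fun i : Fin n => (x i ω, y i ω)) x'|} ≤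
      ENNReal.ofReal (3 * δ / (Real.pi ^ 2 * ((n + 1 : ℕ) : ℝ) ^ 2)) := by
  rw [Set.ofPred_exists]
  refine (measure_iUnion_fintype_le _ _).trans ((Finset.sum_le_sum fun x' _ =>
    h.measure_confidence_fail_le hk hσ hsel hrun n x').trans (le_of_eq ?_))
  rw [Finset.sum_const, Finset.card_univ, nsmul_eq_mul,
    h.lintegral_exp_neg_half_zeta Fintype.card_pos hδ.1]

theorem one_sub_le_measure_cumRegret_le [MeasurableSpace X] [MeasurableSingletonClass X]
    [Nonempty X] (hk : (Matrix.of k).PosSemidef) (hk_le : ∀ x, k x x ≤ 1) (hσ : 0 < σ) {δ : ℝ}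
    (hδ : δ ∈ Set.Ioo (0 : ℝ) 1)
    (h : Model P k σ (shift (Fintype.card X) δ) (1 / 2) f ε ζ U)
    (hsel : IsSelectionRule k σ sel) (hrun : IsRun sel f ε ζ U x y) :
    ENNReal.ofReal (1 - δ) ≤
      P {ω | ∀ T : ℕ, 1 ≤ T → cumRegret f x T ω ≤ regretBound k σ δ T} := by
  set G := {ω | ∀ T : ℕ, 1 ≤ T → cumRegret f x T ω ≤ regretBound k σ δ T} with hG
  let A : ℕ → Set Ω := fun n =>
    {ω | ∃ x', √(ζ n ω) * √(postVar k σ (fun i : Fin n => (x i ω, y i ω)) x') <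
      |f x' ω - postMean k σ (fun i : Fin n => (x i ω, y i ω)) x'|}
  let B : ℕ → Set Ω := fun n =>
    {ω | (n + 1 : ℕ) * shift (Fintype.card X) δ (n + 1) + (n + 1 : ℕ)
        + 2 * √((n + 1 : ℕ) * Real.log (Real.pi ^ 2 * ((n + 1 : ℕ) : ℝ) ^ 2 / (3 * δ)))
        + 2 * Real.log (Real.pi ^ 2 * ((n + 1 : ℕ) : ℝ) ^ 2 / (3 * δ)) <
          ∑ m ∈ Finset.range (n + 1), ζ m ω}
  let Z : ℕ → Set Ω := fun n => {ω | ζ n ω < 0}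
  have hA : P (⋃ n, A n) ≤ ENNReal.ofReal (δ / 2) := measure_iUnion_le_half hδ.1
    fun n => measure_confidence_fail_le hk hσ hδ h hsel hrun n
  have hB : P (⋃ n, B n) ≤ ENNReal.ofReal (δ / 2) := measure_iUnion_le_half hδ.1
    fun n => measure_sum_zeta_gt_le Fintype.card_pos hδ h.zeta_law h.zeta_indep
      (Nat.le_add_left 1 n)
  have hZ : P (⋃ n, Z n) = 0 := measure_iUnion_null fun n =>
    h.ae_zeta_nonneg Fintype.card_pos hδ n
  have hsub : Gᶜ ⊆ ((⋃ n, A n) ∪ ⋃ n, B n) ∪ ⋃ n, Z n := by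
    intro ω hω
    by_contra hcon
    simp only [Set.mem_union, Set.mem_iUnion, not_or, not_exists] at hcon
    obtain ⟨⟨hA', hB'⟩, hZ'⟩ := hcon
    refine hω fun T hT => ?_
    obtain ⟨n, rfl⟩ : ∃ n, T = n + 1 := ⟨T - 1, by omega⟩
    refine cumRegret_le_regretBound hk hk_le hσ hsel hrun
      (fun n => h.postVar_nonneg hk hσ _ _) (fun n => not_lt.1 (hZ' n)) (fun n x' => ?_)
      (not_lt.1 (hB' n))
    exact not_lt.1 fun hlt => hA' n ⟨x', hlt⟩
  have hcompl : P Gᶜ ≤ ENNReal.ofReal δ := by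
    calc P Gᶜ ≤ P (⋃ n, A n) + P (⋃ n, B n) + P (⋃ n, Z n) :=
          (measure_mono hsub).trans ((measure_union_le _ _).trans
            (add_le_add_left (measure_union_le _ _) _))
      _ ≤ ENNReal.ofReal (δ / 2) + ENNReal.ofReal (δ / 2) + 0 :=
          add_le_add (add_le_add hA hB) hZ.le
      _ = ENNReal.ofReal δ := by
          have := hδ.1
          rw [add_zero, ← ENNReal.ofReal_add (by positivity) (by positivity), add_halves]
  -- Subadditivity suffices, so `G` need not be shown measurable.
  have hone : (1 : ℝ≥0∞) ≤ P G + P Gᶜ := by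
    rw [← measure_univ (μ := P), ← Set.union_compl_self G]
    exact measure_union_le _ _
  rw [ENNReal.ofReal_sub _ hδ.1.le, ENNReal.ofReal_one, tsub_le_iff_right]
  exact hone.trans (add_le_add_right hcompl _)

end Regret

end IRGPUCB

theorem mainTheorem8 {Ω X Ξ : Type*} [MeasurableSpace Ω] [MeasurableSpace Ξ]
    [Fintype X] [Nonempty X] [MeasurableSpace X] [MeasurableSingletonClass X]
    (P : Measure Ω) [IsProbabilityMeasure P]
    (k : X → X → ℝ) (hk : (Matrix.of k).PosSemidef) (hk_le : ∀ x, k x x ≤ 1)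
    (σ : ℝ) (hσ : 0 < σ) (δ : ℝ) (hδ : δ ∈ Set.Ioo (0 : ℝ) 1)
    (f : X → Ω → ℝ) (ε ζ : ℕ → Ω → ℝ) (U : Ω → Ξ)
    (hmodel : IRGPUCB.Model P k σ (IRGPUCB.shift (Fintype.card X) δ) (1 / 2) f ε ζ U)
    (sel : ∀ n : ℕ, (Fin n → X × ℝ) → ℝ → Ξ → X) (hsel : IRGPUCB.IsSelectionRule k σ sel)
    (x : ℕ → Ω → X) (y : ℕ → Ω → ℝ) (hrun : IRGPUCB.IsRun sel f ε ζ U x y) :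
    ENNReal.ofReal (1 - δ) ≤
        P {ω | ∀ T : ℕ, 1 ≤ T →
          IRGPUCB.cumRegret f x T ω ≤ IRGPUCB.regretBound k σ δ T} ∧
      ∀ T : ℕ, 1 ≤ T →
        IRGPUCB.gpucbBound k σ δ T ≤ IRGPUCB.regretBound k σ δ T ∧
        IRGPUCB.regretBound k σ δ T ≤ 3 * IRGPUCB.gpucbBound k σ δ T := by
  exact ⟨IRGPUCB.one_sub_le_measure_cumRegret_le hk hk_le hσ hδ hmodel hsel hrun,
    fun T hT => IRGPUCB.gpucbBound_le_regretBound_le k hσ hδ hT⟩
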